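/- Let $k$ be a field and let $(Q,\mathcal P)$ be a thread quiver, that is, an arbitrary (possibly infinite) quiver $Q$ together with a (possibly empty) linearly ordered set $\mathcal P_\alpha$ for every arrow $\alpha$ of $Q$. The path category $\mathcal C$ of $(Q,\mathcal P)$ is the $k$-linear category whose objects are the vertices of $Q$ and the points of the sets $\mathcal P_\alpha$, and whose Hom spaces have the following basis of path-like elements. For a vertex $a$ put $s(a)=t(a)=a$, and for a point $x\in\mathcal P_\alpha$ let $s(x)$ and $t(x)$ be the source and target of $\alpha$. The basis of $\operatorname{Hom}_{\mathcal C}(x,y)$ consists of one element $\eta_{y,s(y)}\,p\,\eta_{t(x),x}$ for each path $p$ in $Q$ from $t(x)$ to $s(y)$ (where $\eta_{a,a}$ is trivial for a vertex $a$) and, when $x\le y$ are points of the same $\mathcal P_\alpha$, one further element $\eta_{y,x}$. Composition is bilinear and given by concatenation of paths together with $\eta_{z,y}\eta_{y,x}=\eta_{z,x}$, $\eta_{y,x}\eta_{x,s(x)}=\eta_{y,s(y)}$ and $\eta_{t(y),y}\eta_{y,x}=\eta_{t(x),x}$ for $x\le y\le z$ in $\mathcal P_\alpha$, and $\eta_{t(x),x}\eta_{x,s(x)}=\alpha$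 for $x\in\mathcal P_\alpha$. Let ${\rm rep}^{\rm pwf}\mathcal C$ be the category of covariant $k$-linear functors from $\mathcal C$ to finite-dimensional $k$-vector spaces. Such a representation is noise if it vanishes at every vertex of $Q$, and noise free if it has no nonzero noise direct summand. Every $M\in{\rm rep}^{\rm pwf}\mathcal C$ has a decomposition, unique up to isomorphism, $M\cong M_{NF}\oplus M_N$ with $M_{NF}$ noise free, $M_N$ noise and $M_N=\bigoplus_{\alpha} U_\alpha$, where $U_\alpha$ is supported in $\mathcal P_\alpha$. The representation $M$ is quasi noise free if, for every arrow $\alpha$, $U_\alpha$ is a direct sum of finitely many indecomposable representations. Let ${\rm rep}^{\rm qnf}\mathcal C$ be the full subcategory of ${\rm rep}^{\rm pwf}\mathcal C$ consisting of the quasi noise free representations. **Theorem.** The category ${\rm rep}^{\rm qnf}\mathcal C$, with its pointwise addition of morphisms, is abelian, and it is hereditary: $\operatorname{Ext}^i(X,Y)=0$ for all $X,Y\in{\rm rep}^{\rm qnf}\mathcal C$ and all $i\ge 2$, where $\operatorname{Ext}$ is computed in ${\rm rep}^{\rm qnf}\mathcal C$. -/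

import Mathlib

open CategoryTheory CategoryTheory.Limits

universe uk u v w

/-- A threading of a quiver `V`: a (possibly empty) linearly ordered set for every arrow. -/
structure ThreadQuiver (V : Type u) [Quiver.{v} V] where
  /-- the linearly ordered set replacing an arrow -/
  thread : ∀ {a b : V}, (a ⟶ b) → Type w
  /-- its order -/
  order : ∀ {a b : V} (α : a ⟶ b), LinearOrder (thread α)

namespace ThreadQuiver

attribute [instance] ThreadQuiver.order

variable {V : Type u} [Quiver.{v} V]

/-- The objects of the path category: the vertices of the quiver, and the points of the threads. -/
inductive Obj (T : ThreadQuiver.{u, v, w} V) : Type (max u v w)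
  | vertex (a : V) : Obj T
  | point {a b : V} (α : a ⟶ b) (x : T.thread α) : Obj T

variable {T : ThreadQuiver.{u, v, w} V}

namespace Obj

/-- The last vertex before an object: a vertex itself, or the source of the arrow. -/
def entry : Obj T → V
  | vertex a => a
  | @point _ _ _ a _ _ _ => a

/-- The first vertex after an object: a vertex itself, or the target of the arrow. -/
def exit : Obj T → V
  | vertex a => a
  | @point _ _ _ _ b _ _ => b

/-- The path of the quiver that runs through an object: `η_{x, s(α)}` followed by `η_{t(α), x}` is
the arrow `α` when `x` is a point of the thread of `α`. -/
def through : (X : Obj T) → Quiver.Path X.entry X.exit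
  | vertex _ => Quiver.Path.nil
  | point α _ => α.toPath

end Obj

/-- The path-like elements, i.e. the basis of the Hom spaces of the path category:
* `thread` is `η_{y, x}` for points `x ≤ y` of the thread of one arrow;
* `path p` is `η_{Y, entry Y} p η_{exit X, X}` for a path `p` of the quiver from `exit X` to
  `entry Y` (where `η_{a, a}` is trivial at a vertex `a`). In particular, `η_{x, s(α)}` and
  `η_{t(α), x}` are obtained from the trivial path. -/
inductive PathLike : Obj T → Obj T → Type (max u v w)
  | thread {a b : V} {α : a ⟶ b} {x y : T.thread α} (h : x ≤ y) :
      PathLike (Obj.point α x) (Obj.point α y)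
  | path {X Y : Obj T} (p : Quiver.Path X.exit Y.entry) : PathLike X Y

namespace PathLike

/-- The trivial path at an object. -/
def id : (X : Obj T) → PathLike X X
  | Obj.vertex _ => path Quiver.Path.nil
  | Obj.point _ x => thread (le_refl x)

/-- Composition of path-like elements (in diagrammatic order). -/
def comp : {X Y Z : Obj T} → PathLike X Y → PathLike Y Z → PathLike X Z
  | _, _, _, thread h, thread h' => thread (h.trans h')
  | _, _, _, thread _, path q => path q
  | _, _, _, path p, thread _ => path p
  | _, Y, _, path p, path q => path (p.comp (Y.through.comp q))

end PathLike

/-- The path-like elements form a category. -/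
instance : Category (Obj T) where
  Hom := PathLike
  id := PathLike.id
  comp := PathLike.comp
  id_comp {X Y} f := by
    cases f with
    | thread h => rfl
    | path p =>
      cases X with
      | vertex a => exact congrArg PathLike.path ((Quiver.Path.nil_comp _).trans
          (Quiver.Path.nil_comp _))
      | point α x => rfl
  comp_id {X Y} f := by
    cases f with
    | thread h => rfl
    | path p =>
      cases Y with
      | vertex a => rfl
      | point α x => rfl
  assoc {W X Y Z} f g h := by
    cases f <;> cases g <;> cases h <;> first | rfl | skip
    exact congrArg PathLike.path (by simp only [Quiver.Path.comp_assoc])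

variable (k : Type uk) [Field k] (T)

/-- The path category of a thread quiver: the `k`-linear category whose Hom spaces have the
path-like elements as a basis, with composition extended bilinearly. -/
abbrev PathCategory := Free k (Obj T)

/-- Pointwise finite-dimensional representations: covariant `k`-linear functors from the path
category to vector spaces, all of whose values are finite-dimensional. -/
structure IsPwf (M : PathCategory T k ⥤ ModuleCat.{uk} k) : Prop where
  additive : M.Additive
  linear : M.Linear k
  finite : ∀ X, Module.Finite k (M.obj X)

/-- `IsPwf` as a property of objects of the functor category. -/
def pwf : ObjectProperty (PathCategory T k ⥤ ModuleCat.{uk} k) := IsPwf T k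

/-- The category `rep^pwf` of pointwise finite-dimensional representations. -/
abbrev RepPwf := (pwf T k).FullSubcategory

instance : (pwf T k).IsClosedUnderIsomorphisms where
  of_iso {M N} e h := by
    have := h.additive
    have := h.linear
    exact ⟨Functor.additive_of_iso e, Functor.linear_of_iso k e, fun X => by
      have := h.finite X
      exact Module.Finite.equiv (e.app X).toLinearEquiv⟩

instance : (pwf T k).IsClosedUnderFiniteProducts where
  isClosedUnderLimitsOfShape J _ := ⟨by
    rintro M ⟨p⟩
    have hl (X : PathCategory T k) :
        IsLimit (((evaluation _ (ModuleCat.{uk} k)).obj X).mapCone p.cone) :=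
      isLimitOfPreserves _ p.isLimit
    have hp (j) : IsPwf T k (p.diag.obj j) := p.prop_diag_obj j
    have ext (X : PathCategory T k) {W : ModuleCat.{uk} k} {f g : W ⟶ M.obj X}
        (h : ∀ j, f ≫ (p.π.app j).app X = g ≫ (p.π.app j).app X) : f = g :=
      (hl X).hom_ext h
    refine ⟨⟨fun {X Y f g} => ext Y fun j => ?_⟩, ⟨fun {X Y} f r => ext Y fun j => ?_⟩,
      fun X => ?_⟩
    · have := (hp j).additive
      have hn (f : X ⟶ Y) : M.map f ≫ (p.π.app j).app Y =
          (p.π.app j).app X ≫ (p.diag.obj j).map f := (p.π.app j).naturality f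
      rw [Preadditive.add_comp, hn, hn, hn, Functor.map_add, Preadditive.comp_add]
    · have := (hp j).linear
      have hn (f : X ⟶ Y) : M.map f ≫ (p.π.app j).app Y =
          (p.π.app j).app X ≫ (p.diag.obj j).map f := (p.π.app j).naturality f
      rw [Linear.smul_comp, hn, hn, Functor.map_smul, Linear.comp_smul]
    · have (j : Discrete J) : Module.Finite k ((p.diag.obj j).obj X) := (hp j).finite X
      have : Finite (Discrete J) := Finite.of_equiv J discreteEquiv.symm
      have : IsNoetherian k (∀ j : Discrete J, (p.diag.obj j).obj X) :=
        isNoetherian_of_isNoetherianRing_of_finite k _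
      let φ : M.obj X →ₗ[k] ∀ j : Discrete J, (p.diag.obj j).obj X :=
        LinearMap.pi fun j => ((p.π.app j).app X).hom
      refine Module.Finite.of_injective φ fun a b hab => ?_
      have h : ModuleCat.ofHom (LinearMap.toSpanSingleton k _ a) =
          ModuleCat.ofHom (LinearMap.toSpanSingleton k _ b) := ext X fun j => by
        have hj : ((p.π.app j).app X).hom a = ((p.π.app j).app X).hom b := congrFun hab j
        ext
        simpa using hj
      simpa using congrArg (fun f => f.hom (1 : k)) h⟩

instance : HasFiniteBiproducts (RepPwf T k) := HasFiniteBiproducts.of_hasFiniteProducts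

instance : HasBinaryBiproducts (RepPwf T k) := hasBinaryBiproducts_of_finite_biproducts _

variable {T k}

/-- The value of a representation at an object. -/
abbrev RepPwf.at (M : RepPwf T k) (X : Obj T) : ModuleCat.{uk} k := M.obj.obj (Free.of k X)

/-- The support of a representation: the objects at which it does not vanish. -/
def RepPwf.support (M : RepPwf T k) : Set (Obj T) := {X | Nontrivial (M.at X)}

/-- A representation is noise if no vertex of the quiver lies in its support. -/
def IsNoise (M : RepPwf T k) : Prop := Disjoint M.support (Set.range Obj.vertex)

/-- `N` is (isomorphic to) a direct summand of `M`. -/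
def IsDirectSummand (N M : RepPwf T k) : Prop := ∃ N' : RepPwf T k, Nonempty (M ≅ N ⊞ N')

/-- A representation is noise free if it has no nonzero direct summand that is noise. -/
def IsNoiseFree (M : RepPwf T k) : Prop :=
  ∀ N : RepPwf T k, IsDirectSummand N M → IsNoise N → IsZero N

/-- A decomposition `M ≅ M_NF ⊕ M_N` into a noise free and a noise representation, together with
a decomposition of `M_N` as the direct sum of representations `U α` supported in the thread of
`α`, where `α` runs over all arrows. -/
structure NoiseDecomposition (M : RepPwf T k) where
  /-- the noise free part -/
  NF : RepPwf T k
  /-- the noise part -/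
  N : RepPwf T k
  noiseFree : IsNoiseFree NF
  noise : IsNoise N
  /-- the decomposition into the two parts -/
  iso : M ≅ NF ⊞ N
  /-- the noise on an arrow -/
  U : (Σ a b : V, a ⟶ b) → RepPwf T k
  support_U : ∀ {a b : V} (α : a ⟶ b), (U ⟨a, b, α⟩).support ⊆ Set.range (Obj.point α)
  /-- the inclusions of the noise on the arrows -/
  ι : ∀ α, U α ⟶ N
  /-- they make the noise part the direct sum of the noise on the arrows -/
  isCoproduct : IsColimit (Cofan.mk N ι)

/-- A direct sum of finitely many (possibly no) indecomposable representations. -/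
def IsFiniteSumOfIndecomposables (M : RepPwf T k) : Prop :=
  ∃ (n : ℕ) (X : Fin n → RepPwf T k), (∀ i, Indecomposable (X i)) ∧ Nonempty (M ≅ ⨁ X)

/-- A pointwise finite-dimensional representation is quasi noise free if, for every arrow, its
noise on that arrow has only finitely many indecomposable direct summands. -/
def IsQuasiNoiseFree (M : RepPwf T k) : Prop :=
  ∃ D : NoiseDecomposition M, ∀ α, IsFiniteSumOfIndecomposables (D.U α)

variable (T k)

/-- `IsQuasiNoiseFree` as a property of objects of `RepPwf`. -/
def qnf : ObjectProperty (RepPwf T k) := IsQuasiNoiseFree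

/-- The category `rep^qnf` of quasi noise free representations, a full subcategory of `rep^pwf`. -/
abbrev RepQnf := (qnf T k).FullSubcategory

end ThreadQuiver

/-- An abelian category is hereditary if its global dimension is at most one, i.e. if
`Ext^i(X, Y) = 0` for all objects `X`, `Y` and all `i ≥ 2`. -/
def IsHereditary (A : Type u) [Category.{v} A] [Abelian A] : Prop :=
  ∀ X : A, HasProjectiveDimensionLE X 1

/-! Call a representation tame on an arrow if its thread is a finite union of intervals inside which
all transition maps are bijective. The pivot is `isQuasiNoiseFree_iff`: a representation is quasi
noise free exactly when it is tame on every arrow.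

Noise on an arrow appears where `ker out` is not contained in `range inn` at some point of the
thread. In that case linear algebra with two flags (images coming in, kernels going out) splits off
an interval representation (`exists_interval_summand`). If the inclusion holds all along the thread,
the ranks of `inn` and `out` are monotone and bounded by the dimensions at the ends, and they cut
the thread into finitely many constant pieces; so noise free representations are tame. An
indecomposable supported in a thread is an interval representation, hence tame, and finite sums stay
tame. Conversely, a tame representation loses dimension at finitely many sample points whenever an
interval is split off, so each thread carries only finitely many noise summands.

Tameness passes to kernels, cokernels and finite products after a common refinement of the pieces;
thus the quasi noise free representations form an abelian subcategory.

For heredity it suffices to factor each `u : E ⟶ W` as a mono `E ⟶ W'` and an epi `W' ⟶ W` with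
kernel inside `E` (`IsHereditary.of_factorization`): such factorizations lift extension classes
along epimorphisms, which kills `Ext²`. Pointwise one takes `W' = E ⊕ coker u`. The pointwise
choices are made functorial by lifting along a full functor that reflects isomorphisms; tameness
reduces each thread to a finite chain, where lifting is free. -/

/-! ### Effaceability of Ext and a criterion for heredity -/

section Effaceable

open CategoryTheory.Abelian

variable {A : Type u} [Category.{v} A] [Abelian A]

/-- A quasi-isomorphism in degree `i` from `Y[-i]` to a complex concentrated in degrees `≥ i` is a
monomorphism in degree `i`. -/
theorem CochainComplex.mono_f_of_quasiIsoAt_single {Y : A} {L : CochainComplex A ℤ} {i : ℤ}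
    (s : (HomologicalComplex.single A (ComplexShape.up ℤ) i).obj Y ⟶ L)
    [L.IsStrictlyGE i] [QuasiIsoAt s i] :
    Mono (s.f i) := by
  -- The incoming differential is zero, so `L.X i` is its own opcycles object and contains the
  -- homology. In degree `i`, `s` is therefore the isomorphism on homology followed by this
  -- inclusion.
  let e := L.pOpcyclesIso (i - 1) i (by simp)
    ((L.isZero_of_isStrictlyGE i (i - 1) (by simp)).eq_of_src _ _)
  let α := (HomologicalComplex.singleObjHomologySelfIso _ _ _).inv ≫
    HomologicalComplex.homologyMap s i ≫ L.homologyι i ≫ e.inv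
  have : s.f i = (HomologicalComplex.singleObjXSelf (ComplexShape.up ℤ) i Y).hom ≫ α := by
    rw [← cancel_mono e.hom]
    change s.f i ≫ L.pOpcycles i = (_ ≫ _ ≫ _ ≫ _ ≫ e.inv) ≫ e.hom
    rw [Category.assoc, Category.assoc, Category.assoc, Category.assoc, e.inv_hom_id,
      Category.comp_id, HomologicalComplex.homologyι_naturality,
      HomologicalComplex.singleObjHomologySelfIso_inv_homologyι_assoc,
      ← HomologicalComplex.pOpcycles_singleObjOpcyclesSelfIso_inv_assoc,
      Iso.inv_hom_id_assoc, HomologicalComplex.p_opcyclesMap]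
  rw [this]
  infer_instance

/-- Morphisms in the derived category from a complex in degrees `≥ n` to an object in a degree
`i < n` are killed by a monomorphism. -/
theorem DerivedCategory.exists_mono_comp_eq_zero [HasDerivedCategory.{w} A] {Y : A}
    {K : CochainComplex A ℤ} {i : ℤ}
    (φ : Q.obj K ⟶ Q.obj ((CochainComplex.singleFunctor A i).obj Y))
    (n : ℤ) (hn : i < n) [K.IsStrictlyGE n] :
    ∃ (E : A) (j : Y ⟶ E), Mono j ∧ φ ≫ Q.map ((CochainComplex.singleFunctor A i).map j) = 0 := by
  obtain ⟨L, _, g, s, h, rfl⟩ := left_fac_of_isStrictlyGE φ i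
  rw [isIso_Q_map_iff_quasiIso] at h
  have hmono := @CochainComplex.mono_f_of_quasiIsoAt_single _ _ _ _ _ _ s _ (h.quasiIsoAt i)
  -- In the fraction `K ⟶ L ⟵ Y`, projecting `L` to its lowest degree `i` kills `g`, as `K` lives in
  -- degrees above `i`, and turns `s` into the monomorphism `j`.
  let π : L ⟶ (CochainComplex.singleFunctor A i).obj (L.X i) :=
    HomologicalComplex.mkHomToSingle (𝟙 _) (by
      rintro j rfl
      apply (L.isZero_of_isStrictlyGE (j + 1) j (by simp)).eq_of_src)
  let j : Y ⟶ L.X i := (HomologicalComplex.singleObjXSelf (ComplexShape.up ℤ) i Y).inv ≫ s.f i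
  have hj : s ≫ π = (CochainComplex.singleFunctor A i).map j := by
    apply HomologicalComplex.to_single_hom_ext
    rw [HomologicalComplex.comp_f]
    erw [HomologicalComplex.mkHomToSingle_f, HomologicalComplex.single_map_f_self]
    simp only [Category.id_comp, j]
    erw [Category.assoc, Iso.hom_inv_id_assoc]
    rfl
  have h₂ : g ≫ π = 0 := by
    apply HomologicalComplex.to_single_hom_ext
    apply (K.isZero_of_isStrictlyGE n i hn).eq_of_src
  refine ⟨L.X i, j, @mono_comp _ _ _ _ _ _ inferInstance _ hmono, ?_⟩
  have : IsIso (Q.map s) := by rwa [isIso_Q_map_iff_quasiIso]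
  rw [← hj, Q.map_comp, Category.assoc, IsIso.inv_hom_id_assoc, ← Q.map_comp, h₂, Q.map_zero]

open DerivedCategory in
/-- Higher extensions are effaceable. -/
theorem CategoryTheory.Abelian.Ext.exists_mono_comp_eq_zero [HasExt.{w} A] {X Y : A} {n : ℕ}
    (e : Ext X Y (n + 1)) :
    ∃ (E : A) (j : Y ⟶ E), Mono j ∧ e.comp (Ext.mk₀ j) (add_zero _) = 0 := by
  let K := (CochainComplex.singleFunctor A 0).obj X
  have := K.isStrictlyGE_of_ge (-n) 0 (by lia)
  let := HasDerivedCategory.standard A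
  obtain ⟨E, j, hj, h⟩ := DerivedCategory.exists_mono_comp_eq_zero (K := K) (n := -n)
    (e.hom ≫ ((singleFunctors A).shiftIso (n + 1) (-(n + 1)) 0 (by lia)).hom.app Y) (by lia)
  refine ⟨E, j, hj, ?_⟩
  ext
  rw [Ext.comp_hom, Ext.mk₀_hom, ShiftedHom.comp_mk₀, Ext.zero_hom,
    ← cancel_mono (((singleFunctors A).shiftIso (n + 1) (-(n + 1)) 0 (by lia)).hom.app E),
    Limits.zero_comp, Category.assoc]
  have := ((singleFunctors A).shiftIso (n + 1) (-(n + 1)) 0 (by lia)).hom.naturality j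
  exact (congrArg (e.hom ≫ ·) this).trans ((Category.assoc _ _ _).symm.trans h)

/-- An abelian category in which every morphism `E ⟶ W` factors as a monomorphism `E ⟶ W'`
followed by an epimorphism `W' ⟶ W` whose kernel is contained in `E` is hereditary. -/
theorem IsHereditary.of_factorization
    (H : ∀ {E W : A} (u : E ⟶ W), ∃ (W' : A) (ι : E ⟶ W') (q : W' ⟶ W), Mono ι ∧ Epi q ∧
      ι ≫ q = u ∧ ∃ t : kernel q ⟶ E, t ≫ ι = kernel.ι q) : IsHereditary A := by
  intro X
  let := HasExt.standard A
  refine HasProjectiveDimensionLT.mk ?_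
  intro i hi Y e
  obtain ⟨n, rfl⟩ : ∃ n, i = n + 2 := ⟨i - 2, by lia⟩
  induction n generalizing Y with
  | succ n ih =>
    obtain ⟨E, j, hj, h⟩ := e.exists_mono_comp_eq_zero
    have hS : (ShortComplex.mk j (cokernel.π j) (by simp)).ShortExact :=
      { exact := ShortComplex.exact_cokernel j }
    obtain ⟨e', rfl⟩ := Ext.covariant_sequence_exact₁ _ hS e h rfl
    rw [ih (by lia) e', Ext.zero_comp]
  | zero =>
    obtain ⟨E, j, hj, h⟩ := e.exists_mono_comp_eq_zero
    have hS : (ShortComplex.mk j (cokernel.π j) (by simp)).ShortExact :=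
      { exact := ShortComplex.exact_cokernel j }
    obtain ⟨e', rfl⟩ := Ext.covariant_sequence_exact₁ _ hS e h (n₀ := 1) rfl
    clear h
    obtain ⟨F, l, hl, h⟩ := e'.exists_mono_comp_eq_zero (n := 0)
    have hS₂ : (ShortComplex.mk l (cokernel.π l) (by simp)).ShortExact :=
      { exact := ShortComplex.exact_cokernel l }
    obtain ⟨e'', rfl⟩ := Ext.covariant_sequence_exact₁ _ hS₂ e' h (n₀ := 0) rfl
    -- The class is now a splice of `Y ⟶ E ⟶ coker j` with `coker j ⟶ F ⟶ coker l`. The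
    -- factorization of `E ⟶ F` supplies an extension of `coker ι` by `E` that maps onto the second
    -- sequence.
    obtain ⟨W, ι, q, hι, hq, hu, t, ht⟩ := H (cokernel.π j ≫ l)
    have hS₃ : (ShortComplex.mk ι (cokernel.π ι) (by simp)).ShortExact :=
      { exact := ShortComplex.exact_cokernel ι }
    let r : cokernel ι ⟶ cokernel l := cokernel.desc ι (q ≫ cokernel.π l) (by
      rw [reassoc_of% hu]
      exact (congrArg _ (cokernel.condition l)).trans comp_zero)
    -- The kernel of `q` lies in `E`, so `cokernel.π ι` descends along `q`. This yields a section
    -- `d'` of `r`.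
    let d : F ⟶ cokernel ι := Abelian.epiDesc q (cokernel.π ι) (by
      rw [← ht, Category.assoc, cokernel.condition, comp_zero])
    have hd : q ≫ d = cokernel.π ι := Abelian.comp_epiDesc _ _ _
    let d' : cokernel l ⟶ cokernel ι := cokernel.desc l d (by
      rw [← cancel_epi (cokernel.π j), ← Category.assoc, ← hu, Category.assoc, hd,
        cokernel.condition, comp_zero])
    have hdr : d' ≫ r = 𝟙 _ := by
      rw [← cancel_epi (cokernel.π l), ← cancel_epi q]
      simp [d', reassoc_of% hd, r]
    let f : ShortComplex.mk ι (cokernel.π ι) (by simp) ⟶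
        ShortComplex.mk l (cokernel.π l) (by simp) :=
      { τ₁ := cokernel.π j
        τ₂ := q
        τ₃ := r
        comm₁₂ := hu.symm
        comm₂₃ := by simp [r] }
    have hnat := ShortComplex.ShortExact.extClass_naturality hS₃ hS₂ f
    -- The class of the second sequence is the image of a class with values in `E`; the composite `E
    -- ⟶ coker j` followed by the class of the first sequence is zero.
    have hcl : hS₂.extClass = (Ext.mk₀ d').comp
        (hS₃.extClass.comp (Ext.mk₀ (cokernel.π j)) (add_zero 1)) (zero_add 1) := by
      rw [hnat, Ext.mk₀_comp_mk₀_assoc, hdr, Ext.mk₀_id_comp]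
    rw [hcl]
    have h0 := hS.comp_extClass
    dsimp at h0
    rw [Ext.comp_assoc (a₂₃ := 2) _ _ _ _ rfl (by lia), Ext.comp_assoc (a₂₃ := 2) _ _ _ _ rfl (by lia),
      Ext.comp_assoc (a₂₃ := 1) _ _ _ _ rfl (by lia), h0, Ext.comp_zero, Ext.comp_zero, Ext.comp_zero]

end Effaceable

/-! ### Generators and relations of the path-like elements -/

namespace ThreadQuiver

section Generators

variable {V : Type u} [Quiver.{v} V] {T : ThreadQuiver.{u, v, w} V}

namespace Obj

/-- The morphism `η_{y, x}` for points `x ≤ y` of a thread. -/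
def thr {a b : V} {α : a ⟶ b} {x y : T.thread α} (h : x ≤ y) : point α x ⟶ point α y :=
  PathLike.thread h

/-- The morphism `η_{x, s(α)}`. -/
def inn {a b : V} (α : a ⟶ b) (x : T.thread α) : (vertex a : Obj T) ⟶ point α x :=
  PathLike.path (Y := point α x) Quiver.Path.nil

/-- The morphism `η_{t(α), x}`. -/
def out {a b : V} (α : a ⟶ b) (x : T.thread α) : point α x ⟶ (vertex b : Obj T) :=
  PathLike.path (X := point α x) Quiver.Path.nil

/-- The morphism between vertices given by a path. -/
def ofPath {a b : V} (p : Quiver.Path a b) : (vertex a : Obj T) ⟶ vertex b :=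
  PathLike.path (X := vertex a) (Y := vertex b) p

/-- The morphism `η_{X, entry X}`. -/
def fromEntry (X : Obj T) : vertex X.entry ⟶ X :=
  PathLike.path (X := vertex X.entry) Quiver.Path.nil

/-- The morphism `η_{exit X, X}`. -/
def toExit (X : Obj T) : X ⟶ vertex X.exit :=
  PathLike.path (Y := vertex X.exit) Quiver.Path.nil

theorem ofPath_comp {a b c : V} (p : Quiver.Path a b) (q : Quiver.Path b c) :
    (ofPath p ≫ ofPath q : (vertex a : Obj T) ⟶ vertex c) = ofPath (p.comp q) :=
  congrArg (fun p => PathLike.path (X := vertex a) (Y := vertex c) p)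
    (congrArg p.comp (Quiver.Path.nil_comp q))

theorem path_eq {X Y : Obj T} (p : Quiver.Path X.exit Y.entry) :
    (PathLike.path p : PathLike X Y) = toExit X ≫ ofPath p ≫ fromEntry Y := by
  refine congrArg (fun p => PathLike.path (X := X) (Y := Y) p) (?_ : p = _)
  change p = Quiver.Path.comp _ (Quiver.Path.comp _ (Quiver.Path.comp p
    (Quiver.Path.comp Quiver.Path.nil Quiver.Path.nil)))
  simp only [Quiver.Path.comp_nil]
  exact ((Quiver.Path.nil_comp _).trans (Quiver.Path.nil_comp _)).symm

end Obj

open Obj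

/-- Values of a functor on the generators of the category `Obj T`, on given objects. -/
structure Generators {D : Type*} [Category D] (obj : Obj T → D) where
  thr : ∀ {a b : V} {α : a ⟶ b} {x y : T.thread α}, x ≤ y → (obj (point α x) ⟶ obj (point α y))
  inn : ∀ {a b : V} (α : a ⟶ b) (x : T.thread α), obj (vertex a) ⟶ obj (point α x)
  out : ∀ {a b : V} (α : a ⟶ b) (x : T.thread α), obj (point α x) ⟶ obj (vertex b)
  arr : ∀ {a b : V}, (a ⟶ b) → (obj (vertex a) ⟶ obj (vertex b))
  thr_refl : ∀ {a b : V} {α : a ⟶ b} (x : T.thread α), thr (le_refl x) = 𝟙 _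
  thr_comp : ∀ {a b : V} {α : a ⟶ b} {x y z : T.thread α} (h : x ≤ y) (h' : y ≤ z),
    thr h ≫ thr h' = thr (h.trans h')
  inn_thr : ∀ {a b : V} {α : a ⟶ b} {x y : T.thread α} (h : x ≤ y), inn α x ≫ thr h = inn α y
  thr_out : ∀ {a b : V} {α : a ⟶ b} {x y : T.thread α} (h : x ≤ y), thr h ≫ out α y = out α x
  inn_out : ∀ {a b : V} (α : a ⟶ b) (x : T.thread α), inn α x ≫ out α x = arr α

namespace Generators

variable {D : Type*} [Category D] {obj : Obj T → D} (G : Generators obj)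

/-- The values on paths. -/
def pathMap {a : V} : {b : V} → Quiver.Path a b → (obj (vertex a) ⟶ obj (vertex b))
  | _, .nil => 𝟙 _
  | _, .cons p e => pathMap p ≫ G.arr e

theorem pathMap_comp {a b c : V} (p : Quiver.Path a b) (q : Quiver.Path b c) :
    G.pathMap (p.comp q) = G.pathMap p ≫ G.pathMap q := by
  induction q with
  | nil => exact (Category.comp_id _).symm
  | cons q e ih => simp [pathMap, ih]

/-- The value on `Obj.inn`. -/
def innMap : (X : Obj T) → (obj (vertex X.entry) ⟶ obj X)
  | vertex _ => 𝟙 _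
  | point α x => G.inn α x

/-- The value on `Obj.out`. -/
def outMap : (X : Obj T) → (obj X ⟶ obj (vertex X.exit))
  | vertex _ => 𝟙 _
  | point α x => G.out α x

theorem innMap_outMap (X : Obj T) : G.innMap X ≫ G.outMap X = G.pathMap X.through := by
  cases X with
  | vertex a => exact Category.comp_id _
  | point α x => exact (G.inn_out α x).trans (Category.id_comp _).symm

/-- The value on a path-like element. -/
def map : {X Y : Obj T} → PathLike X Y → (obj X ⟶ obj Y)
  | _, _, .thread h => G.thr h
  | X, Y, .path p => G.outMap X ≫ G.pathMap p ≫ G.innMap Y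

/-- The functor with given values on the generators. -/
@[simps]
def functor : Obj T ⥤ D where
  obj := obj
  map := G.map
  map_id X := by
    cases X with
    | vertex a => exact (Category.id_comp _).trans (Category.id_comp _)
    | point α x => exact G.thr_refl x
  map_comp {X Y Z} f g := by
    change PathLike X Y at f
    change PathLike Y Z at g
    cases f with
    | thread h =>
      cases g with
      | thread h' => exact (G.thr_comp h h').symm
      | path q => exact ((Category.assoc _ _ _).symm.trans (congrArg (· ≫ _) (G.thr_out h))).symm
    | path p =>
      cases g with
      | thread h =>
        exact ((Category.assoc _ _ _).trans (congrArg (_ ≫ ·)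
          ((Category.assoc _ _ _).trans (congrArg (_ ≫ ·) (G.inn_thr h))))).symm
      | path q =>
        change _ ≫ G.pathMap (p.comp (Y.through.comp q)) ≫ _ = (_ ≫ _ ≫ _) ≫ (_ ≫ _ ≫ _)
        simp only [pathMap_comp, ← innMap_outMap, Category.assoc]

/-- A functor with given values on the generators is determined by them. -/
theorem map_eq (m : ∀ {X Y : Obj T}, (X ⟶ Y) → (obj X ⟶ obj Y)) (m_id : ∀ X, m (𝟙 X) = 𝟙 _)
    (m_comp : ∀ {X Y Z : Obj T} (f : X ⟶ Y) (g : Y ⟶ Z), m (f ≫ g) = m f ≫ m g)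
    (hthr : ∀ {a b : V} {α : a ⟶ b} {x y : T.thread α} (h : x ≤ y), G.thr h = m (Obj.thr h))
    (hinn : ∀ {a b : V} (α : a ⟶ b) (x : T.thread α), G.inn α x = m (Obj.inn α x))
    (hout : ∀ {a b : V} (α : a ⟶ b) (x : T.thread α), G.out α x = m (Obj.out α x))
    (harr : ∀ {a b : V} (α : a ⟶ b), G.arr α = m (Obj.ofPath α.toPath))
    {X Y : Obj T} (f : X ⟶ Y) : G.map f = m f := by
  have hinn' (X : Obj T) : G.innMap X = m (fromEntry X) := by
    cases X with
    | vertex a => exact (m_id _).symm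
    | point α x => exact hinn α x
  have hout' (X : Obj T) : G.outMap X = m (toExit X) := by
    cases X with
    | vertex a => exact (m_id _).symm
    | point α x => exact hout α x
  have hpath {a b : V} (p : Quiver.Path a b) : G.pathMap p = m (ofPath p) := by
    induction p with
    | nil => exact (m_id _).symm
    | cons p e ih =>
      have := m_comp (ofPath p : (_ : Obj T) ⟶ _) (ofPath e.toPath)
      rw [ofPath_comp] at this
      exact (congrArg₂ (· ≫ ·) ih (harr e)).trans this.symm
  change PathLike X Y at f
  cases f with
  | thread h => exact hthr h
  | path p =>
    have := (m_comp (toExit X) (ofPath p ≫ fromEntry Y)).trans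
      (congrArg (_ ≫ ·) (m_comp (ofPath p) (fromEntry Y)))
    rw [← hinn', ← hout', ← hpath, ← path_eq] at this
    exact this.symm

/-- The images of the generators under a functor. -/
@[simps]
def mapFunctor {D' : Type*} [Category D'] (π : D ⥤ D') : Generators (fun X => π.obj (obj X)) where
  thr h := π.map (G.thr h)
  inn α x := π.map (G.inn α x)
  out α x := π.map (G.out α x)
  arr α := π.map (G.arr α)
  thr_refl x := by rw [G.thr_refl, π.map_id]
  thr_comp h h' := by rw [← π.map_comp, G.thr_comp]
  inn_thr h := by rw [← π.map_comp, G.inn_thr]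
  thr_out h := by rw [← π.map_comp, G.thr_out]
  inn_out α x := by rw [← π.map_comp, G.inn_out]

theorem mapFunctor_map {D' : Type*} [Category D'] (π : D ⥤ D') {X Y : Obj T} (f : X ⟶ Y) :
    (G.mapFunctor π).map f = π.map (G.map f) := by
  refine (G.mapFunctor π).map_eq (fun f => π.map (G.map f)) (fun X => ?_) (fun f g => ?_)
    (fun h => rfl) (fun α x => ?_) (fun α x => ?_) (fun α => ?_) f
  · exact (congrArg π.map (G.functor.map_id X)).trans (π.map_id _)
  · exact (congrArg π.map (G.functor.map_comp f g)).trans (π.map_comp _ _)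
  · refine congrArg π.map ?_
    change _ = 𝟙 _ ≫ 𝟙 _ ≫ _
    simp [innMap]
  · refine congrArg π.map ?_
    change _ = _ ≫ 𝟙 _ ≫ 𝟙 _
    simp [outMap]
  · refine congrArg π.map ?_
    change _ = 𝟙 _ ≫ (𝟙 _ ≫ _) ≫ 𝟙 _
    exact (((Category.id_comp _).trans (Category.comp_id _)).trans (Category.id_comp _)).symm

end Generators

/-! ### Lifting functors along a full functor that reflects isomorphisms -/

section Lift

variable {E B : Type*} [Category E] [Category B] (π : E ⥤ B)

/-- A monotone and bounded function on a nonempty linear order factors through a monotone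
surjection onto a finite chain, with the same fibres. -/
theorem exists_chain {P : Type*} [LinearOrder P] [Nonempty P] (f : P → ℕ) (hf : Monotone f)
    (N : ℕ) (hN : ∀ x, f x ≤ N) :
    ∃ (n : ℕ) (r : P →o Fin (n + 1)) (g : Fin (n + 1) →o P), (∀ i, r (g i) = i) ∧
      ∀ x y, r x = r y → f x = f y := by
  classical
  have hfin : (Set.range f).Finite :=
    (Set.finite_Iic N).subset (by rintro _ ⟨x, rfl⟩; exact hN x)
  have := hfin.fintype
  have hpos : 0 < Fintype.card (Set.range f) := Fintype.card_pos
  obtain ⟨n, hn⟩ : ∃ n, Fintype.card (Set.range f) = n + 1 := ⟨_, (Nat.succ_pred_eq_of_pos hpos).symm⟩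
  let e := Fintype.orderIsoFinOfCardEq _ hn
  have hr (i : Fin (n + 1)) : ∃ x, e.symm ⟨f x, x, rfl⟩ = i := by
    obtain ⟨⟨_, x, rfl⟩, h⟩ := e.symm.surjective i
    exact ⟨x, h⟩
  choose g hg using hr
  let r : P →o Fin (n + 1) := ⟨fun x => e.symm ⟨f x, x, rfl⟩, fun x y h => e.symm.monotone (hf h)⟩
  refine ⟨n, r, ⟨g, fun i j h => ?_⟩, hg, fun x y h => congrArg Subtype.val (e.symm.injective h)⟩
  rcases h.eq_or_lt with rfl | h
  · exact le_rfl
  · by_contra! hlt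
    have := r.monotone hlt.le
    change e.symm _ ≤ e.symm _ at this
    rw [hg, hg] at this
    exact absurd h (not_lt_of_ge this)

/-- A functor on a finite chain can be lifted along a full functor. -/
theorem exists_lift_fin [π.Full] {n : ℕ} (obj : Fin (n + 1) → E)
    (μ : ∀ {i j : Fin (n + 1)}, i ≤ j → (π.obj (obj i) ⟶ π.obj (obj j)))
    (μ_refl : ∀ i, μ (le_refl i) = 𝟙 _)
    (μ_comp : ∀ {i j l : Fin (n + 1)} (h : i ≤ j) (h' : j ≤ l), μ h ≫ μ h' = μ (h.trans h')) :
    ∃ (m : ∀ {i j : Fin (n + 1)}, i ≤ j → (obj i ⟶ obj j)), (∀ i, m (le_refl i) = 𝟙 _) ∧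
      (∀ {i j l : Fin (n + 1)} (h : i ≤ j) (h' : j ≤ l), m h ≫ m h' = m (h.trans h')) ∧
      ∀ {i j : Fin (n + 1)} (h : i ≤ j), π.map (m h) = μ h := by
  -- A finite chain is free on its successive steps, so arbitrary preimages of these steps assemble
  -- to a functor.
  let R : ComposableArrows E n := ComposableArrows.mkOfObjOfMapSucc obj
    (fun i => π.preimage (μ i.castSucc_lt_succ.le))
  have hR (i : Fin n) : R.map (homOfLE i.castSucc_lt_succ.le) = π.preimage
      (μ i.castSucc_lt_succ.le) :=
    ComposableArrows.mkOfObjOfMapSucc_map_succ _ _ i i.2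
  obtain ⟨m, m_refl, m_comp, hmR⟩ : ∃ (m : ∀ {i j : Fin (n + 1)}, i ≤ j → (obj i ⟶ obj j)),
      (∀ i, m (le_refl i) = 𝟙 _) ∧
      (∀ {i j l : Fin (n + 1)} (h : i ≤ j) (h' : j ≤ l), m h ≫ m h' = m (h.trans h')) ∧
      ∀ i : Fin n, m i.castSucc_lt_succ.le = π.preimage (μ i.castSucc_lt_succ.le) :=
    ⟨fun h => R.map (homOfLE h), fun i => R.map_id _, fun h h' => (R.map_comp _ _).symm, hR⟩
  have hm (i : Fin n) : π.map (m i.castSucc_lt_succ.le) = μ i.castSucc_lt_succ.le := by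
    rw [hmR, π.map_preimage]
  refine ⟨m, m_refl, m_comp, fun {i j} h => ?_⟩
  change π.map (m h) = μ h
  induction j using Fin.induction with
  | zero =>
    obtain rfl : i = 0 := Fin.le_zero_iff.mp h
    rw [m_refl, μ_refl, π.map_id]
  | succ j ih =>
    rcases h.eq_or_lt with rfl | h'
    · rw [m_refl, μ_refl, π.map_id]
    · have hi : i ≤ j.castSucc := Fin.le_castSucc_iff.mpr h'
      rw [← m_comp hi j.castSucc_lt_succ.le, ← μ_comp hi j.castSucc_lt_succ.le, π.map_comp, ih, hm]

/-- The lifting problem on one thread. -/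
theorem exists_lift_thread [π.Full] [π.ReflectsIsomorphisms] {P : Type*} [LinearOrder P]
    (f : P → ℕ) (hf : Monotone f) (N : ℕ) (hN : ∀ x, f x ≤ N) (obj : P → E) (A C : E)
    (t' : ∀ {x y : P}, x ≤ y → (π.obj (obj x) ⟶ π.obj (obj y)))
    (i' : ∀ x, π.obj A ⟶ π.obj (obj x)) (o' : ∀ x, π.obj (obj x) ⟶ π.obj C)
    (r' : π.obj A ⟶ π.obj C) (refl' : ∀ x, t' (le_refl x) = 𝟙 _)
    (comp' : ∀ {x y z : P} (h : x ≤ y) (h' : y ≤ z), t' h ≫ t' h' = t' (h.trans h'))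
    (inn' : ∀ {x y : P} (h : x ≤ y), i' x ≫ t' h = i' y)
    (out' : ∀ {x y : P} (h : x ≤ y), t' h ≫ o' y = o' x)
    (arr' : ∀ x, i' x ≫ o' x = r')
    (hiso : ∀ {x y : P} (h : x ≤ y), f x = f y → IsIso (t' h)) :
    ∃ (t : ∀ {x y : P}, x ≤ y → (obj x ⟶ obj y)) (i : ∀ x, A ⟶ obj x)
      (o : ∀ x, obj x ⟶ C) (r : A ⟶ C),
      ((∀ x, t (le_refl x) = 𝟙 _) ∧
        (∀ {x y z : P} (h : x ≤ y) (h' : y ≤ z), t h ≫ t h' = t (h.trans h')) ∧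
        (∀ {x y : P} (h : x ≤ y), i x ≫ t h = i y) ∧
        (∀ {x y : P} (h : x ≤ y), t h ≫ o y = o x) ∧
        (∀ x, i x ≫ o x = r)) ∧
      (∀ {x y : P} (h : x ≤ y), π.map (t h) = t' h) ∧
      (∀ x, π.map (i x) = i' x) ∧ (∀ x, π.map (o x) = o' x) ∧ π.map r = r' := by
  rcases isEmpty_or_nonempty P with hP | hP
  · exact ⟨fun {x} => isEmptyElim x, isEmptyElim, isEmptyElim, π.preimage r',
      ⟨isEmptyElim, fun {x} => isEmptyElim x, fun {x} => isEmptyElim x, fun {x} => isEmptyElim x,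
        isEmptyElim⟩, fun {x} => isEmptyElim x, isEmptyElim, isEmptyElim, π.map_preimage _⟩
  obtain ⟨n, r, g, hrg, hr⟩ := exists_chain f hf N hN
  obtain ⟨ρ, ρ_refl, ρ_comp, hρ⟩ := exists_lift_fin π (fun j => obj (g j))
    (fun h => t' (g.monotone h)) (fun j => refl' _) (fun h h' => comp' _ _)
  -- The representative `g (r x)` may lie on either side of `x`; the comparison is the transition
  -- map or its inverse accordingly.
  have hκ (x : P) : ∃ κ : π.obj (obj x) ≅ π.obj (obj (g (r x))),
      (∀ h : x ≤ g (r x), κ.hom = t' h) ∧ ∀ h : g (r x) ≤ x, κ.inv = t' h := by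
    have hx : f x = f (g (r x)) := hr _ _ (hrg _).symm
    rcases le_total x (g (r x)) with h | h
    · have := hiso h hx
      refine ⟨asIso (t' h), fun _ => rfl, fun h' => ?_⟩
      rw [← cancel_epi (asIso (t' h)).hom, Iso.hom_inv_id]
      exact ((comp' h h').trans (refl' x)).symm
    · have := hiso h hx.symm
      refine ⟨(asIso (t' h)).symm, fun h' => ?_, fun _ => rfl⟩
      rw [← cancel_mono (asIso (t' h)).hom]
      exact (Iso.inv_hom_id _).trans ((comp' h' h).trans (refl' x)).symm
  choose κ hκ₁ hκ₂ using hκ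
  have κ_thr {x y : P} (h : x ≤ y) (hg : g (r x) ≤ g (r y)) :
      (κ x).hom ≫ t' hg = t' h ≫ (κ y).hom := by
    rcases le_total x (g (r x)) with hx | hx <;> rcases le_total y (g (r y)) with hy | hy
    · rw [hκ₁ x hx, hκ₁ y hy, comp', comp']
    · rw [← Iso.comp_inv_eq, hκ₁ x hx, hκ₂ y hy, comp', comp']
    · rw [← Iso.eq_inv_comp, hκ₂ x hx, hκ₁ y hy, comp', comp']
    · rw [← Iso.eq_inv_comp, ← Category.assoc, ← Iso.comp_inv_eq, hκ₂ x hx, hκ₂ y hy, comp', comp']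
  have κ_inn (x : P) : i' (g (r x)) ≫ (κ x).inv = i' x := by
    rcases le_total x (g (r x)) with hx | hx
    · rw [Iso.comp_inv_eq, hκ₁ x hx, inn']
    · rw [hκ₂ x hx, inn']
  have κ_out (x : P) : (κ x).hom ≫ o' (g (r x)) = o' x := by
    rcases le_total x (g (r x)) with hx | hx
    · rw [hκ₁ x hx, out']
    · rw [← Iso.eq_inv_comp, hκ₂ x hx, out']
  have hθ (x : P) : ∃ θ : obj x ≅ obj (g (r x)), π.map θ.hom = (κ x).hom := by
    have : IsIso (π.map (π.preimage (κ x).hom)) := by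
      rw [π.map_preimage]
      infer_instance
    have := isIso_of_reflects_iso (π.preimage (κ x).hom) π
    exact ⟨asIso (π.preimage (κ x).hom), π.map_preimage _⟩
  choose θ hθ using hθ
  have hθ' (x) : π.map (θ x).inv = (κ x).inv := by
    rw [← cancel_epi (κ x).hom, Iso.hom_inv_id, ← hθ, ← π.map_comp, Iso.hom_inv_id, π.map_id]
  -- Everything is routed through the chain of representatives: only the entry into its first point
  -- and the exit from its last one are lifted. Hence all composites `i x ≫ o x` are the same map,
  -- which serves as the lift of the arrow.
  refine ⟨fun h => (θ _).hom ≫ ρ (r.monotone h) ≫ (θ _).inv,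
    fun x => π.preimage (i' (g 0)) ≫ ρ (Fin.zero_le _) ≫ (θ x).inv,
    fun x => (θ x).hom ≫ ρ (Fin.le_last _) ≫ π.preimage (o' (g (Fin.last n))),
    π.preimage (i' (g 0)) ≫ ρ (Fin.zero_le _) ≫ π.preimage (o' (g (Fin.last n))),
    ⟨fun x => by simp [ρ_refl], fun h h' => by simp [reassoc_of% (@ρ_comp)],
      fun h => by simp [reassoc_of% (@ρ_comp)], fun h => by simp [reassoc_of% (@ρ_comp)],
      fun x => by simp [reassoc_of% (@ρ_comp)]⟩, fun h => ?_, fun x => ?_, fun x => ?_, ?_⟩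
  · rw [π.map_comp, π.map_comp, hθ, hθ', hρ, ← Category.assoc, κ_thr h, Category.assoc,
      Iso.hom_inv_id, Category.comp_id]
  · rw [π.map_comp, π.map_comp, hθ', hρ, π.map_preimage, ← Category.assoc, inn', κ_inn]
  · rw [π.map_comp, π.map_comp, hθ, hρ, π.map_preimage, out', κ_out]
  · rw [π.map_comp, π.map_comp, hρ, π.map_preimage, π.map_preimage, out', arr']

variable [π.Full] [π.ReflectsIsomorphisms] (obj : Obj T → E)
  (m : ∀ {X Y : Obj T}, (X ⟶ Y) → (π.obj (obj X) ⟶ π.obj (obj Y))) (m_id : ∀ X, m (𝟙 X) = 𝟙 _)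
  (m_comp : ∀ {X Y Z : Obj T} (f : X ⟶ Y) (g : Y ⟶ Z), m (f ≫ g) = m f ≫ m g)

include m_id m_comp in
/-- A functor on `Obj T` which is constant on the pieces of finite partitions of the threads into
intervals can be lifted along a full functor that reflects isomorphisms. -/
theorem exists_lift (htame : ∀ {a b : V} (α : a ⟶ b), ∃ (f : T.thread α → ℕ) (N : ℕ), Monotone f ∧
      (∀ x, f x ≤ N) ∧ ∀ {x y : T.thread α} (h : x ≤ y), f x = f y → IsIso (m (thr h))) :
    ∃ G : Generators obj, ∀ {X Y : Obj T} (f : X ⟶ Y), π.map (G.map f) = m f := by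
  -- No relation involves generators of two different arrows, so the threads can be lifted
  -- independently.
  have H {a b : V} (α : a ⟶ b) := (htame α).elim fun f h => h.elim fun N h =>
    exists_lift_thread π f h.1 N h.2.1 (fun x => obj (point α x)) (obj (vertex a))
      (obj (vertex b)) (fun h => m (thr h)) (fun x => m (inn α x)) (fun x => m (out α x))
      (m (ofPath α.toPath)) (fun x => m_id _) (fun _ _ => (m_comp _ _).symm)
      (fun _ => (m_comp _ _).symm) (fun _ => (m_comp _ _).symm) (fun _ => (m_comp _ _).symm) h.2.2
  choose t i o r h₁ h₂ h₃ h₄ h₅ using @H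
  let G : Generators obj :=
    { thr := t _
      inn := i
      out := o
      arr := r
      thr_refl := (h₁ _).1
      thr_comp := (h₁ _).2.1
      inn_thr := (h₁ _).2.2.1
      thr_out := (h₁ _).2.2.2.1
      inn_out := fun α => (h₁ α).2.2.2.2 }
  refine ⟨G, fun f => ?_⟩
  rw [← G.mapFunctor_map]
  exact (G.mapFunctor π).map_eq m m_id m_comp (fun h => h₂ _ h) h₃ h₄ h₅ f

end Lift

end Generators

end ThreadQuiver

/-! ### Pointwise finite-dimensional representations: abelian structure and pointwise exactness -/

namespace ThreadQuiver

section Pwf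

variable {k : Type uk} [Field k] {V : Type u} [Quiver.{v} V] {T : ThreadQuiver.{u, v, w} V}

instance : (pwf T k).ContainsZero where
  exists_zero := by
    have hz : IsZero (ModuleCat.of k PUnit.{uk + 1}) := ModuleCat.isZero_of_subsingleton _
    refine ⟨(Functor.const _).obj (ModuleCat.of k PUnit.{uk + 1}), (Functor.isZero_iff _).mpr fun _ => hz,
      ⟨fun {X Y f g} => hz.eq_of_src _ _⟩, ⟨fun {X Y} f r => hz.eq_of_src _ _⟩, fun X => ?_⟩
    exact inferInstanceAs (Module.Finite k PUnit.{uk + 1})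

instance : (pwf T k).IsClosedUnderSubobjects where
  prop_of_mono {M N} i _ h := by
    have := h.additive
    have := h.linear
    refine ⟨⟨fun {X Y f g} => ?_⟩, ⟨fun {X Y} f r => ?_⟩, fun X => ?_⟩
    · rw [← cancel_mono (i.app Y)]
      simp [Functor.map_add]
    · rw [← cancel_mono (i.app Y)]
      simp [Functor.map_smul]
    · have := h.finite X
      exact Module.Finite.of_injective (i.app X).hom ((ModuleCat.mono_iff_injective _).1 inferInstance)

instance : (pwf T k).IsClosedUnderQuotients where
  prop_of_epi {M N} p _ h := by
    have := h.additive
    have := h.linear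
    refine ⟨⟨fun {X Y f g} => ?_⟩, ⟨fun {X Y} f r => ?_⟩, fun X => ?_⟩
    · rw [← cancel_epi (p.app X)]
      simp only [← p.naturality, Preadditive.comp_add, Functor.map_add, Preadditive.add_comp]
    · rw [← cancel_epi (p.app X)]
      simp only [← p.naturality, Linear.comp_smul, Functor.map_smul, Linear.smul_comp]
    · have := h.finite X
      exact Module.Finite.of_surjective (p.app X).hom ((ModuleCat.epi_iff_surjective _).1 inferInstance)

noncomputable instance : Abelian (RepPwf T k) := inferInstance

variable (k T) in
/-- Evaluation at an object of the path category. -/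
noncomputable def evaluationAt (X : Obj T) : RepPwf T k ⥤ ModuleCat.{uk} k :=
  (pwf T k).ι ⋙ (evaluation _ _).obj (Free.of k X)

instance (X : Obj T) : (evaluationAt k T X).Additive where
  map_add := rfl

instance (X : Obj T) : PreservesFiniteLimits (evaluationAt k T X) := by
  have : PreservesFiniteLimits (pwf T k).ι := by
    have := (pwf T k).preservesKernels_ι
    exact Functor.preservesFiniteLimits_of_preservesKernels _
  unfold evaluationAt
  infer_instance

instance (X : Obj T) : PreservesFiniteColimits (evaluationAt k T X) := by
  have : PreservesFiniteColimits (pwf T k).ι := by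
    have := (pwf T k).preservesCokernels_ι
    exact Functor.preservesFiniteColimits_of_preservesCokernels _
  unfold evaluationAt
  infer_instance

namespace RepPwf

instance (M : RepPwf T k) (X : Obj T) : Module.Finite k (M.at X) := M.property.finite _

/-- The linear map associated with a path-like element. -/
noncomputable def mp (M : RepPwf T k) {X Y : Obj T} (f : X ⟶ Y) : M.at X →ₗ[k] M.at Y :=
  (M.obj.map ((Free.embedding k _).map f)).hom

/-- The component of a morphism at an object. -/
def app {M N : RepPwf T k} (φ : M ⟶ N) (X : Obj T) : M.at X →ₗ[k] N.at X :=
  (φ.hom.app (Free.of k X)).hom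

variable {M N L : RepPwf T k} {X Y Z : Obj T}

theorem mp_id : M.mp (𝟙 X) = LinearMap.id := by
  have := M.obj.map_id (Free.of k X)
  exact congrArg ModuleCat.Hom.hom this

theorem mp_comp (f : X ⟶ Y) (g : Y ⟶ Z) : M.mp (f ≫ g) = M.mp g ∘ₗ M.mp f := by
  have := M.obj.map_comp ((Free.embedding k _).map f) ((Free.embedding k _).map g)
  rw [← Functor.map_comp] at this
  exact congrArg ModuleCat.Hom.hom this

theorem mp_mp (f : X ⟶ Y) (g : Y ⟶ Z) (m : M.at X) : M.mp g (M.mp f m) = M.mp (f ≫ g) m := by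
  rw [mp_comp]
  rfl

theorem app_mp (φ : M ⟶ N) (f : X ⟶ Y) (m : M.at X) :
    app φ Y (M.mp f m) = N.mp f (app φ X m) :=
  congrArg (fun g => g.hom m) (φ.hom.naturality ((Free.embedding k _).map f))

@[simp] theorem app_id (m : M.at X) : app (𝟙 M) X m = m := rfl

@[simp] theorem app_comp (φ : M ⟶ N) (ψ : N ⟶ L) (m : M.at X) :
    app (φ ≫ ψ) X m = app ψ X (app φ X m) := rfl

@[simp] theorem app_zero (m : M.at X) : app (0 : M ⟶ N) X m = 0 := rfl

theorem hom_ext {φ ψ : M ⟶ N} (h : ∀ X m, app φ X m = app ψ X m) : φ = ψ := by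
  ext X m
  exact h X m

/-- A morphism of representations from linear maps that commute with the path-like elements. -/
noncomputable def homMk (φ : ∀ X, M.at X →ₗ[k] N.at X)
    (h : ∀ {X Y : Obj T} (f : X ⟶ Y) (m : M.at X), φ Y (M.mp f m) = N.mp f (φ X m)) : M ⟶ N :=
  ObjectProperty.homMk
    { app := fun X => ModuleCat.ofHom (φ X)
      naturality := fun X Y f => by
        have := M.property.additive
        have := N.property.additive
        have := M.property.linear
        have := N.property.linear
        -- Both functors are linear, so naturality need only be known on the basis of path-like
        -- elements.
        induction f using Finsupp.induction_linear with
        | zero =>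
          refine (congrArg (· ≫ _) (M.obj.map_zero X Y)).trans
            (zero_comp.trans (((congrArg (_ ≫ ·) (N.obj.map_zero X Y)).trans comp_zero).symm))
        | add f g hf hg =>
          exact (congrArg (· ≫ _) (M.obj.map_add (f := f) (g := g))).trans
            ((Preadditive.add_comp _ _ _ _ _ _).trans ((congrArg₂ (· + ·) hf hg).trans
              (((congrArg (_ ≫ ·) (N.obj.map_add (f := f) (g := g))).trans
                (Preadditive.comp_add _ _ _ _ _ _)).symm)))
        | single f r =>
          have hf : (Finsupp.single f r : X ⟶ Y) = r • (Finsupp.single f 1 : X ⟶ Y) :=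
            (Finsupp.smul_single_one f r).symm
          have h₀ : M.obj.map (Finsupp.single f 1 : X ⟶ Y) ≫ ModuleCat.ofHom (φ Y) =
              ModuleCat.ofHom (φ X) ≫ N.obj.map (Finsupp.single f 1 : X ⟶ Y) := by
            ext m
            exact h f m
          have h₁ : M.obj.map (r • (Finsupp.single f 1 : X ⟶ Y)) = r • M.obj.map _ :=
            Functor.map_smul _ _ _
          have h₂ : N.obj.map (r • (Finsupp.single f 1 : X ⟶ Y)) = r • N.obj.map _ :=
            Functor.map_smul _ _ _
          rw [hf]
          exact (congrArg (· ≫ ModuleCat.ofHom (φ Y)) h₁).trans ((Linear.smul_comp _ _ _ _ _ _).trans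
            ((congrArg (r • ·) h₀).trans (((congrArg (ModuleCat.ofHom (φ X) ≫ ·) h₂).trans
              (Linear.comp_smul _ _ _ _ _ _)).symm))) }

@[simp]
theorem app_homMk (φ : ∀ X, M.at X →ₗ[k] N.at X) (h) (m : M.at X) :
    app (homMk φ h) X m = φ X m := rfl

/-- The linear extension of a functor to formal linear combinations of morphisms. -/
noncomputable def linearMapOf (F : Obj T ⥤ ModuleCat.{uk} k) (X Y : Obj T) :
    ((X ⟶ Y) →₀ k) →ₗ[k] (F.obj X ⟶ F.obj Y) :=
  Finsupp.linearCombination k fun f : X ⟶ Y => F.map f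

theorem linearMapOf_single (F : Obj T ⥤ ModuleCat.{uk} k) (f : X ⟶ Y) :
    linearMapOf F X Y (Finsupp.single f 1) = F.map f :=
  (Finsupp.linearCombination_single k 1 f).trans (one_smul k _)

theorem linearMapOf_comp (F : Obj T ⥤ ModuleCat.{uk} k) (f : (X ⟶ Y) →₀ k) (g : (Y ⟶ Z) →₀ k) :
    linearMapOf F X Z (f.sum fun f' s => g.sum fun g' t => Finsupp.single (f' ≫ g') (s * t)) =
      linearMapOf F X Y f ≫ linearMapOf F Y Z g := by
  unfold linearMapOf
  rw [Finsupp.linearCombination_apply k f, Finsupp.linearCombination_apply k g]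
  simp only [Finsupp.sum, map_sum, Finsupp.linearCombination_single, Functor.map_comp,
    Preadditive.sum_comp, Preadditive.comp_sum, Linear.smul_comp, Linear.comp_smul,
    Finset.smul_sum, smul_smul]
  rw [Finset.sum_comm]
  simp only [mul_comm]

/-- The `k`-linear extension of a functor on path-like elements. -/
noncomputable def lift (F : Obj T ⥤ ModuleCat.{uk} k) : PathCategory T k ⥤ ModuleCat.{uk} k where
  obj X := F.obj X
  map {X Y} f := linearMapOf F X Y f
  map_id X := (linearMapOf_single F _).trans (F.map_id X)
  map_comp f g := linearMapOf_comp F f g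

/-- The representation with given values on path-like elements. -/
noncomputable def ofFunctor (F : Obj T ⥤ ModuleCat.{uk} k) (hF : ∀ X, Module.Finite k (F.obj X)) :
    RepPwf T k where
  obj := lift F
  property :=
    { additive := ⟨fun {X Y f g} => map_add (linearMapOf F X Y) f g⟩
      linear := ⟨fun {X Y} f r => map_smul (linearMapOf F X Y) r f⟩
      finite := hF }

theorem ofFunctor_mp (F : Obj T ⥤ ModuleCat.{uk} k) (hF) (f : X ⟶ Y) :
    (ofFunctor F hF).mp f = (F.map f).hom :=
  congrArg ModuleCat.Hom.hom (linearMapOf_single F f)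

section Exact

theorem app_injective (φ : M ⟶ N) [Mono φ] (X : Obj T) : Function.Injective (app φ X) :=
  (ModuleCat.mono_iff_injective _).1 (inferInstanceAs (Mono ((evaluationAt k T X).map φ)))

theorem app_surjective (φ : M ⟶ N) [Epi φ] (X : Obj T) : Function.Surjective (app φ X) :=
  (ModuleCat.epi_iff_surjective _).1 (inferInstanceAs (Epi ((evaluationAt k T X).map φ)))

theorem exact_app {S : ShortComplex (RepPwf T k)} (hS : S.Exact) (X : Obj T) :
    Function.Exact (app S.f X) (app S.g X) := by
  have := hS.map (evaluationAt k T X)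
  exact (ShortComplex.ShortExact.moduleCat_exact_iff_function_exact _).1 this

theorem isZero_iff : IsZero M ↔ ∀ X, Subsingleton (M.at X) := by
  refine ⟨fun h X => ModuleCat.subsingleton_of_isZero ((evaluationAt k T X).map_isZero h), fun h => ?_⟩
  rw [IsZero.iff_id_eq_zero]
  exact hom_ext fun X m => (h X).elim _ _

theorem mono_of_injective (φ : M ⟶ N) (h : ∀ X, Function.Injective (app φ X)) : Mono φ :=
  ⟨fun _ _ hfg => hom_ext fun X m => h X (congrArg (fun ψ => app ψ X m) hfg)⟩

theorem epi_of_surjective (φ : M ⟶ N) (h : ∀ X, Function.Surjective (app φ X)) : Epi φ :=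
  ⟨fun _ _ hfg => hom_ext fun X m => by
    obtain ⟨m, rfl⟩ := h X m
    exact congrArg (fun ψ => app ψ X m) hfg⟩

end Exact

end RepPwf

end Pwf

end ThreadQuiver

/-! ### Tame representations and their closure properties -/

namespace ThreadQuiver

section Tame

variable {k : Type uk} [Field k] {V : Type u} [Quiver.{v} V] {T : ThreadQuiver.{u, v, w} V}

open RepPwf

/-- A representation is tame on an arrow if the thread of the arrow is the union of finitely many
intervals on which the representation is constant. -/
def IsTameOn (M : RepPwf T k) {a b : V} (α : a ⟶ b) : Prop :=
  ∃ (f : T.thread α → ℕ) (N : ℕ), Monotone f ∧ (∀ x, f x ≤ N) ∧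
    ∀ {x y : T.thread α} (h : x ≤ y), f x = f y → Function.Bijective (M.mp (Obj.thr h))

variable {M N L K : RepPwf T k} {a b : V} {α : a ⟶ b}

theorem IsTameOn.of_bijective (hM : IsTameOn M α)
    (H : ∀ {x y : T.thread α} (h : x ≤ y), Function.Bijective (M.mp (Obj.thr h)) →
      Function.Bijective (L.mp (Obj.thr h))) : IsTameOn L α := by
  obtain ⟨f, n, hf, hn, h⟩ := hM
  exact ⟨f, n, hf, hn, fun hxy hfxy => H hxy (h hxy hfxy)⟩

/-- The sum of the step functions is a common refinement: a sum of monotone functions takes equal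
values at `x ≤ y` only if every summand does. -/
theorem IsTameOn.exists_common {ι : Type*} [Finite ι] {M : ι → RepPwf T k}
    (hM : ∀ i, IsTameOn (M i) α) :
    ∃ (f : T.thread α → ℕ) (n : ℕ), Monotone f ∧ (∀ x, f x ≤ n) ∧
      ∀ {x y : T.thread α} (h : x ≤ y), f x = f y →
        ∀ i, Function.Bijective ((M i).mp (Obj.thr h)) := by
  have := Fintype.ofFinite ι
  choose f n hf hn h using hM
  refine ⟨fun x => ∑ i, f i x, ∑ i, n i, fun x y hxy => Finset.sum_le_sum fun i _ => hf i hxy,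
    fun x => Finset.sum_le_sum fun i _ => hn i x, fun {x y} hxy hfxy i => h i hxy ?_⟩
  exact (Finset.sum_eq_sum_iff_of_le fun i _ => hf i hxy).1 hfxy i (Finset.mem_univ i)

theorem IsTameOn.exists_common₂ (hM : IsTameOn M α) (hN : IsTameOn N α) :
    ∃ (f : T.thread α → ℕ) (n : ℕ), Monotone f ∧ (∀ x, f x ≤ n) ∧
      ∀ {x y : T.thread α} (h : x ≤ y), f x = f y →
        Function.Bijective (M.mp (Obj.thr h)) ∧ Function.Bijective (N.mp (Obj.thr h)) := by
  obtain ⟨f, n, hf, hn, h⟩ := IsTameOn.exists_common (M := fun b : Bool => cond b M N) (α := α)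
    (fun b => by cases b <;> assumption)
  exact ⟨f, n, hf, hn, fun hxy hfxy => ⟨h hxy hfxy true, h hxy hfxy false⟩⟩

theorem bijective_mp_of_retract (i : L ⟶ M) (r : M ⟶ L) (h : i ≫ r = 𝟙 L) {X Y : Obj T}
    {f : X ⟶ Y} (hf : Function.Bijective (M.mp f)) : Function.Bijective (L.mp f) := by
  have hir (Z : Obj T) (m : L.at Z) : app r Z (app i Z m) = m := congrArg (fun ψ => app ψ Z m) h
  refine ⟨fun m m' hm => ?_, fun m => ?_⟩
  · have := congrArg (app i Y) hm
    rw [app_mp, app_mp] at this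
    rw [← hir X m, hf.1 this, hir]
  · obtain ⟨m', hm'⟩ := hf.2 (app i Y m)
    exact ⟨app r X m', by rw [← app_mp, hm', hir]⟩

theorem bijective_mp_kernel (φ : M ⟶ N) {X Y : Obj T} {f : X ⟶ Y}
    (hM : Function.Bijective (M.mp f)) (hN : Function.Bijective (N.mp f)) :
    Function.Bijective ((kernel φ).mp f) := by
  have hex := exact_app (ShortComplex.exact_kernel φ)
  refine ⟨fun m m' hm => ?_, fun m => ?_⟩
  · have := congrArg (app (kernel.ι φ) Y) hm
    rw [app_mp, app_mp] at this
    exact app_injective (kernel.ι φ) X (hM.1 this)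
  · obtain ⟨m', hm'⟩ := hM.2 (app (kernel.ι φ) Y m)
    have h0 : app φ X m' = 0 := by
      apply hN.1
      rw [← app_mp, hm', map_zero]
      exact (hex Y _).2 ⟨m, rfl⟩
    obtain ⟨m'', hm''⟩ := (hex X _).1 h0
    refine ⟨m'', app_injective (kernel.ι φ) Y ?_⟩
    rw [app_mp]
    exact (congrArg _ hm'').trans hm'

theorem bijective_mp_cokernel (φ : M ⟶ N) {X Y : Obj T} {f : X ⟶ Y}
    (hM : Function.Bijective (M.mp f)) (hN : Function.Bijective (N.mp f)) :
    Function.Bijective ((cokernel φ).mp f) := by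
  have hex := exact_app (ShortComplex.exact_cokernel φ)
  refine ⟨(injective_iff_map_eq_zero _).2 fun m hm => ?_, fun m => ?_⟩
  · obtain ⟨m, rfl⟩ := app_surjective (cokernel.π φ) X m
    rw [← app_mp] at hm
    obtain ⟨l, hl⟩ := (hex Y _).1 hm
    obtain ⟨l, rfl⟩ := hM.2 l
    refine (hex X _).2 ⟨l, hN.1 ?_⟩
    rw [← hl, ← app_mp]
  · obtain ⟨m, rfl⟩ := app_surjective (cokernel.π φ) Y m
    obtain ⟨m, rfl⟩ := hN.2 m
    exact ⟨app (cokernel.π φ) X m, (app_mp _ _ _).symm⟩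

/-- Only the resolution of the identity is used, so this applies to biproducts and to arbitrary
finite product cones alike. -/
theorem bijective_mp_sum {ι : Type*} [Fintype ι] {X : ι → RepPwf T k} (p : ∀ i, M ⟶ X i)
    (j : ∀ i, X i ⟶ M) (hp : ∑ i, p i ≫ j i = 𝟙 M) {A B : Obj T} {f : A ⟶ B}
    (hf : ∀ i, Function.Bijective ((X i).mp f)) : Function.Bijective (M.mp f) := by
  have hsum (Z : Obj T) (m : M.at Z) : ∑ i, app (j i) Z (app (p i) Z m) = m := by
    let F : (M ⟶ M) →+ M.at Z := ⟨⟨fun ψ => app ψ Z m, rfl⟩, fun _ _ => rfl⟩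
    have := congrArg F hp
    rw [map_sum] at this
    exact this
  refine ⟨(injective_iff_map_eq_zero _).2 fun m hm => ?_, fun m => ?_⟩
  · rw [← hsum A m]
    refine Finset.sum_eq_zero fun i _ => ?_
    have : app (p i) A m = 0 := by
      apply (hf i).1
      rw [← app_mp, hm, map_zero, map_zero]
    rw [this, map_zero]
  · choose m' hm' using fun i => (hf i).2 (app (p i) B m)
    refine ⟨∑ i, app (j i) A (m' i), ?_⟩
    rw [map_sum, ← hsum B m]
    refine Finset.sum_congr rfl fun i _ => ?_
    rw [← app_mp, hm']

theorem IsTameOn.of_retract (hM : IsTameOn M α) (i : L ⟶ M) (r : M ⟶ L) (h : i ≫ r = 𝟙 L) :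
    IsTameOn L α :=
  hM.of_bijective fun _ => bijective_mp_of_retract i r h

theorem IsTameOn.of_iso (hM : IsTameOn M α) (e : M ≅ L) : IsTameOn L α :=
  hM.of_retract e.inv e.hom e.inv_hom_id

theorem IsTameOn.kernel (hM : IsTameOn M α) (hN : IsTameOn N α) (φ : M ⟶ N) :
    IsTameOn (kernel φ) α := by
  obtain ⟨f, n, hf, hn, h⟩ := hM.exists_common₂ hN
  exact ⟨f, n, hf, hn, fun hxy hfxy => bijective_mp_kernel φ (h hxy hfxy).1 (h hxy hfxy).2⟩

theorem IsTameOn.cokernel (hM : IsTameOn M α) (hN : IsTameOn N α) (φ : M ⟶ N) :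
    IsTameOn (cokernel φ) α := by
  obtain ⟨f, n, hf, hn, h⟩ := hM.exists_common₂ hN
  exact ⟨f, n, hf, hn, fun hxy hfxy => bijective_mp_cokernel φ (h hxy hfxy).1 (h hxy hfxy).2⟩

theorem IsTameOn.sum {ι : Type*} [Fintype ι] {X : ι → RepPwf T k} (p : ∀ i, M ⟶ X i)
    (j : ∀ i, X i ⟶ M) (hp : ∑ i, p i ≫ j i = 𝟙 M) (hX : ∀ i, IsTameOn (X i) α) :
    IsTameOn M α := by
  obtain ⟨f, n, hf, hn, h⟩ := IsTameOn.exists_common hX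
  exact ⟨f, n, hf, hn, fun hxy hfxy => bijective_mp_sum p j hp (h hxy hfxy)⟩

theorem IsTameOn.biproduct {n : ℕ} {X : Fin n → RepPwf T k} (hX : ∀ i, IsTameOn (X i) α) :
    IsTameOn (⨁ X) α :=
  IsTameOn.sum (biproduct.π X) (biproduct.ι X) biproduct.total hX

theorem IsTameOn.biprod (hM : IsTameOn M α) (hN : IsTameOn N α) : IsTameOn (M ⊞ N) α :=
  IsTameOn.sum (ι := Bool) (X := fun i => cond i M N)
    (fun i => match i with | true => biprod.fst | false => biprod.snd)
    (fun i => match i with | true => biprod.inl | false => biprod.inr)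
    (by rw [Fintype.sum_bool]; exact biprod.total) (fun i => by cases i <;> assumption)

theorem IsTameOn.of_subsingleton (hM : ∀ x : T.thread α, Subsingleton (M.at (Obj.point α x))) :
    IsTameOn M α :=
  ⟨fun _ => 0, 0, monotone_const, fun _ => le_rfl, fun {x y} _ _ =>
    ⟨fun _ _ _ => (hM x).elim _ _, fun _ => ⟨0, (hM y).elim _ _⟩⟩⟩

end Tame

end ThreadQuiver

/-! ### Functorial factorization of morphisms between tame representations -/

namespace ThreadQuiver

section Factorization

/-- A monomorphism `E ⟶ W'` followed by an epimorphism `W' ⟶ W` with kernel contained in `E`. -/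
structure MonoEpi (k : Type uk) [Field k] where
  {E W' W : ModuleCat.{uk} k}
  ι : E ⟶ W'
  q : W' ⟶ W
  injective : Function.Injective ι.hom
  surjective : Function.Surjective q.hom
  exists_of_eq_zero : ∀ x, q.hom x = 0 → ∃ e, ι.hom e = x

namespace MonoEpi

variable {k : Type uk} [Field k]

/-- Morphisms of factorizations. -/
@[ext]
structure Hom (A B : MonoEpi k) where
  left : A.E ⟶ B.E
  mid : A.W' ⟶ B.W'
  right : A.W ⟶ B.W
  comm_ι : A.ι ≫ mid = left ≫ B.ι
  comm_q : A.q ≫ right = mid ≫ B.q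

instance : Category (MonoEpi k) where
  Hom := Hom
  id A := ⟨𝟙 _, 𝟙 _, 𝟙 _, by simp, by simp⟩
  comp f g := ⟨f.left ≫ g.left, f.mid ≫ g.mid, f.right ≫ g.right,
    by rw [← Category.assoc, f.comm_ι, Category.assoc, g.comm_ι, Category.assoc],
    by rw [← Category.assoc, f.comm_q, Category.assoc, g.comm_q, Category.assoc]⟩
  id_comp f := Hom.ext (Category.id_comp _) (Category.id_comp _) (Category.id_comp _)
  comp_id f := Hom.ext (Category.comp_id _) (Category.comp_id _) (Category.comp_id _)
  assoc f g h := Hom.ext (Category.assoc _ _ _) (Category.assoc _ _ _) (Category.assoc _ _ _)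

/-- The composition of the two maps. -/
def toArrow : MonoEpi k ⥤ Arrow (ModuleCat.{uk} k) where
  obj A := Arrow.mk (A.ι ≫ A.q)
  map {A B} f := Arrow.homMk (u := f.left) (v := f.right) (by
    have h₁ := f.comm_ι
    have h₂ := f.comm_q
    simp only [Arrow.mk_hom, Category.assoc, h₂]
    rw [← Category.assoc, ← Category.assoc, h₁])

/-- The middle object. -/
def middle : MonoEpi k ⥤ ModuleCat.{uk} k where
  obj A := A.W'
  map f := f.mid

/-- Over a field `A.ι` has a retraction and `B.q` a section. The middle map is prescribed on the
image of `A.ι`, and the section corrects it on the complement. -/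
instance : (toArrow (k := k)).Full where
  map_surjective {A B} g := by
    obtain ⟨ρ, hρ⟩ := A.ι.hom.exists_leftInverse_of_injective (LinearMap.ker_eq_bot.2 A.injective)
    obtain ⟨s, hs⟩ := B.q.hom.exists_rightInverse_of_surjective
      (LinearMap.range_eq_top.2 B.surjective)
    have hρ' (x) : ρ (A.ι.hom x) = x := LinearMap.congr_fun hρ x
    have hs' (x) : B.q.hom (s x) = x := LinearMap.congr_fun hs x
    let l : A.E ⟶ B.E := g.left
    let r : A.W ⟶ B.W := g.right
    have hw (x : A.E) : B.q.hom (B.ι.hom (l.hom x)) = r.hom (A.q.hom (A.ι.hom x)) :=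
      congrArg (fun f => f.hom x) (Arrow.w g)
    let μ : A.W' →ₗ[k] B.W' := B.ι.hom ∘ₗ l.hom ∘ₗ ρ +
      s ∘ₗ r.hom ∘ₗ A.q.hom ∘ₗ (LinearMap.id - A.ι.hom ∘ₗ ρ)
    refine ⟨⟨l, ModuleCat.ofHom μ, r, ?_, ?_⟩, rfl⟩
    · ext x
      simp [μ, hρ']
    · ext x
      simp [μ, hs', hw]

/-- A diagram chase as in the five lemma; the condition that the kernel of `q` lies in `E` is what
lets the outer maps control the middle one. -/
theorem isIso_of_isIso {A B : MonoEpi k} (f : A ⟶ B) [IsIso f.left] [IsIso f.right] : IsIso f := by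
  have hι (x) : f.mid.hom (A.ι.hom x) = B.ι.hom (f.left.hom x) :=
    congrArg (fun g => g.hom x) f.comm_ι
  have hq (x) : f.right.hom (A.q.hom x) = B.q.hom (f.mid.hom x) :=
    congrArg (fun g => g.hom x) f.comm_q
  have hl := (ConcreteCategory.isIso_iff_bijective f.left).1 inferInstance
  have hr := (ConcreteCategory.isIso_iff_bijective f.right).1 inferInstance
  have : IsIso f.mid := by
    rw [ConcreteCategory.isIso_iff_bijective]
    refine ⟨(injective_iff_map_eq_zero f.mid.hom).2 fun x hx => ?_, fun y => ?_⟩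
    · have h0 : A.q.hom x = 0 := by
        apply hr.1
        exact (hq x).trans (by rw [hx, map_zero]; exact (map_zero f.right.hom).symm)
      obtain ⟨e, rfl⟩ := A.exists_of_eq_zero x h0
      rw [hι] at hx
      have : f.left.hom e = 0 := B.injective (hx.trans (map_zero _).symm)
      have : e = 0 := hl.1 (this.trans (map_zero f.left.hom).symm)
      rw [this, map_zero]
    · obtain ⟨w, hw⟩ := hr.2 (B.q.hom y)
      obtain ⟨x, rfl⟩ := A.surjective w
      obtain ⟨e, he⟩ := B.exists_of_eq_zero (y - f.mid.hom x) (by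
        rw [map_sub, ← hq]
        exact sub_eq_zero.2 hw.symm)
      obtain ⟨e, rfl⟩ := hl.2 e
      refine ⟨x + A.ι.hom e, (map_add f.mid.hom _ _).trans ?_⟩
      rw [hι]
      exact (congrArg (_ + ·) he).trans (add_sub_cancel _ _)
  refine ⟨⟨inv f.left, inv f.mid, inv f.right, ?_, ?_⟩, ?_, ?_⟩
  · rw [IsIso.comp_inv_eq, Category.assoc, f.comm_ι, IsIso.inv_hom_id_assoc]
  · rw [IsIso.comp_inv_eq, Category.assoc, f.comm_q, IsIso.inv_hom_id_assoc]
  · exact Hom.ext (IsIso.hom_inv_id _) (IsIso.hom_inv_id _) (IsIso.hom_inv_id _)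
  · exact Hom.ext (IsIso.inv_hom_id _) (IsIso.inv_hom_id _) (IsIso.inv_hom_id _)

instance : (toArrow (k := k)).ReflectsIsomorphisms where
  reflects {A B} f hf := by
    have : IsIso f.left := (Arrow.leftFunc (C := ModuleCat.{uk} k)).map_isIso (toArrow.map f)
    have : IsIso f.right := (Arrow.rightFunc (C := ModuleCat.{uk} k)).map_isIso (toArrow.map f)
    exact isIso_of_isIso f

/-- A factorization of a linear map. -/
theorem exists_factorization {E W : ModuleCat.{uk} k} (u : E ⟶ W) [Module.Finite k E]
    [Module.Finite k W] : ∃ (W' : ModuleCat.{uk} k) (ι : E ⟶ W') (q : W' ⟶ W),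
      Module.Finite k W' ∧ ι ≫ q = u ∧ Function.Injective ι.hom ∧ Function.Surjective q.hom ∧
      ∀ x, q.hom x = 0 → ∃ e, ι.hom e = x := by
  obtain ⟨s, hs⟩ := (LinearMap.range u.hom).mkQ.exists_rightInverse_of_surjective
    (LinearMap.range_eq_top.2 (Submodule.mkQ_surjective _))
  have hs' (x) : (LinearMap.range u.hom).mkQ (s x) = x := LinearMap.congr_fun hs x
  -- The section embeds the cokernel of `u` as a complement of its image: the two span `W`, and
  -- their trivial intersection forces the kernel of `q` into `E`.
  refine ⟨ModuleCat.of k (E × (W ⧸ LinearMap.range u.hom)), ModuleCat.ofHom (LinearMap.inl k _ _),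
    ModuleCat.ofHom (LinearMap.coprod u.hom s), inferInstanceAs (Module.Finite k (E × _)), ?_,
    LinearMap.inl_injective, fun w => ?_, ?_⟩
  · ext x
    simp
  · have : w - s ((LinearMap.range u.hom).mkQ w) ∈ LinearMap.range u.hom := by
      refine (Submodule.Quotient.mk_eq_zero _).1 ?_
      exact (map_sub (LinearMap.range u.hom).mkQ _ _).trans (sub_eq_zero.2 (hs' _).symm)
    obtain ⟨e, he⟩ := this
    refine ⟨(e, (LinearMap.range u.hom).mkQ w), ?_⟩
    change u.hom e + s ((LinearMap.range u.hom).mkQ w) = w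
    rw [he, sub_add_cancel]
  · rintro ⟨e, c⟩ h
    change u.hom e + s c = 0 at h
    have hc : c = 0 := by
      have := congrArg (LinearMap.range u.hom).mkQ h
      rw [map_add, hs', map_zero] at this
      have h0 : (LinearMap.range u.hom).mkQ (u.hom e) = 0 :=
        (Submodule.Quotient.mk_eq_zero _).2 ⟨e, rfl⟩
      rwa [h0, zero_add] at this
    exact ⟨e, by rw [hc]; rfl⟩

end MonoEpi

open RepPwf

variable {k : Type uk} [Field k] {V : Type u} [Quiver.{v} V] {T : ThreadQuiver.{u, v, w} V}

/-- The morphism `u` is a functor from `Obj T` to arrows. Pointwise factorizations lift its objects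
to `MonoEpi`, and `exists_lift` lifts the maps on common constant pieces of `M` and `N`. The middle
term is constant on the same pieces. -/
theorem exists_factorization_of_isTameOn {M N : RepPwf T k} (u : M ⟶ N)
    (hM : ∀ {a b : V} (α : a ⟶ b), IsTameOn M α) (hN : ∀ {a b : V} (α : a ⟶ b), IsTameOn N α) :
    ∃ (L : RepPwf T k) (ι : M ⟶ L) (q : L ⟶ N), (∀ {a b : V} (α : a ⟶ b), IsTameOn L α) ∧
      ι ≫ q = u ∧ (∀ X, Function.Injective (app ι X)) ∧ (∀ X, Function.Surjective (app q X)) ∧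
      ∀ X x, app q X x = 0 → ∃ e, app ι X e = x := by
  choose W' ι q hfin hu hinj hsurj hker using fun X : Obj T =>
    MonoEpi.exists_factorization (E := M.at X) (W := N.at X) (u.hom.app (Free.of k X))
  let obj (X : Obj T) : MonoEpi k := ⟨ι X, q X, hinj X, hsurj X, hker X⟩
  let m {X Y : Obj T} (f : X ⟶ Y) : MonoEpi.toArrow.obj (obj X) ⟶ MonoEpi.toArrow.obj (obj Y) :=
    Arrow.homMk (u := ModuleCat.ofHom (M.mp f)) (v := ModuleCat.ofHom (N.mp f)) (by
      change _ ≫ ι Y ≫ q Y = (ι X ≫ q X) ≫ _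
      rw [hu, hu]
      ext x
      exact app_mp u f x)
  obtain ⟨G, hG⟩ := exists_lift MonoEpi.toArrow obj @m
    (fun X => by
      ext x
      · exact LinearMap.congr_fun (mp_id (M := M) (X := X)) x
      · exact LinearMap.congr_fun (mp_id (M := N) (X := X)) x)
    (fun f g => by
      ext x
      · exact LinearMap.congr_fun (mp_comp (M := M) f g) x
      · exact LinearMap.congr_fun (mp_comp (M := N) f g) x)
    (fun α => by
      obtain ⟨f, n, hf, hn, h⟩ := (hM α).exists_common₂ (hN α)
      refine ⟨f, n, hf, hn, fun hxy hfxy => ?_⟩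
      have h₁ : IsIso (ModuleCat.ofHom (M.mp (Obj.thr hxy))) :=
        (ConcreteCategory.isIso_iff_bijective _).2 (h hxy hfxy).1
      have h₂ : IsIso (ModuleCat.ofHom (N.mp (Obj.thr hxy))) :=
        (ConcreteCategory.isIso_iff_bijective _).2 (h hxy hfxy).2
      have h₁' : IsIso (m (Obj.thr hxy)).left := h₁
      have h₂' : IsIso (m (Obj.thr hxy)).right := h₂
      exact Arrow.isIso_of_isIso_left_of_isIso_right _)
  have hl {X Y : Obj T} (f : X ⟶ Y) : (G.map f).left = ModuleCat.ofHom (M.mp f) :=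
    congrArg (fun g => g.left) (hG f)
  have hr {X Y : Obj T} (f : X ⟶ Y) : (G.map f).right = ModuleCat.ofHom (N.mp f) :=
    congrArg (fun g => g.right) (hG f)
  let L : RepPwf T k := ofFunctor (G.functor ⋙ MonoEpi.middle) hfin
  have hL {X Y : Obj T} (f : X ⟶ Y) : L.mp f = (G.map f).mid.hom := ofFunctor_mp _ _ f
  let ι' : M ⟶ L := homMk (fun X => (ι X).hom) (fun {X Y} f x => by
    rw [hL]
    have := (G.map f).comm_ι
    rw [hl] at this
    exact congrArg (fun g => g.hom x) this.symm)
  let q' : L ⟶ N := homMk (fun X => (q X).hom) (fun {X Y} f x => by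
    rw [hL]
    have := (G.map f).comm_q
    rw [hr] at this
    exact congrArg (fun g => g.hom x) this.symm)
  refine ⟨L, ι', q', fun α => ?_, hom_ext fun X x => congrArg (fun g => g.hom x) (hu X), hinj, hsurj,
    hker⟩
  obtain ⟨f, n, hf, hn, h⟩ := (hM α).exists_common₂ (hN α)
  refine ⟨f, n, hf, hn, fun hxy hfxy => ?_⟩
  have h₁ : IsIso (G.map (Obj.thr hxy)).left := by
    rw [hl]
    exact (ConcreteCategory.isIso_iff_bijective _).2 (h hxy hfxy).1
  have h₂ : IsIso (G.map (Obj.thr hxy)).right := by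
    rw [hr]
    exact (ConcreteCategory.isIso_iff_bijective _).2 (h hxy hfxy).2
  have := MonoEpi.isIso_of_isIso (G.map (Obj.thr hxy))
  have h₃ : IsIso (MonoEpi.middle.map (G.map (Obj.thr hxy))) := inferInstance
  rw [hL]
  exact (ConcreteCategory.isIso_iff_bijective _).1 h₃

end Factorization

end ThreadQuiver

/-! ### Linear algebra of persistence modules, and morphisms supported in one thread -/

namespace ThreadQuiver

section LinearAlgebra

variable {k : Type*} [Field k]

/-- A functional on a member of a directed system that vanishes on the kernels of the transition
maps extends to a compatible family of functionals. -/
theorem exists_compatible_functionals {ι : Type*} [LinearOrder ι] {G : ι → Type*}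
    [∀ i, AddCommGroup (G i)] [∀ i, Module k (G i)] (t : ∀ i j, i ≤ j → G i →ₗ[k] G j)
    (refl : ∀ i x, t i i le_rfl x = x)
    (comp : ∀ i j l (h : i ≤ j) (h' : j ≤ l) x, t j l h' (t i j h x) = t i l (h.trans h') x)
    (s : ι) (φ : G s →ₗ[k] k) (hφ : ∀ j (h : s ≤ j) x, t s j h x = 0 → φ x = 0) :
    ∃ Φ : ∀ i, G i →ₗ[k] k, Φ s = φ ∧ ∀ i j h x, Φ j (t i j h x) = Φ i x := by
  classical
  have : DirectedSystem G (fun i j h => t i j h) := ⟨fun i x => refl i x, fun _ _ _ h h' x => comp _ _ _ h h' x⟩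
  -- An element dying in the direct limit already dies at a finite stage, so `φ` factors through the
  -- image of `G s` in the limit and extends from there.
  have hker : φ ∈ (LinearMap.ker (Module.DirectLimit.of k ι G t s)).dualAnnihilator := by
    rw [Submodule.mem_dualAnnihilator]
    intro x hx
    obtain ⟨j, h, h0⟩ := Module.DirectLimit.of.zero_exact hx
    exact hφ j h x h0
  rw [← LinearMap.range_dualMap_eq_dualAnnihilator_ker] at hker
  obtain ⟨Ψ, rfl⟩ := hker
  exact ⟨fun i => Ψ ∘ₗ Module.DirectLimit.of k ι G t i, rfl, fun i j h x =>
    congrArg Ψ Module.DirectLimit.of_f⟩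

/-- An element of a member of an inverse system of finite-dimensional spaces that lies in the
images of all transition maps extends to a compatible family of elements. -/
theorem exists_compatible_elements {ι : Type*} [LinearOrder ι] {G : ι → Type*}
    [∀ i, AddCommGroup (G i)] [∀ i, Module k (G i)] [∀ i, Module.Finite k (G i)]
    (t : ∀ i j, i ≤ j → G i →ₗ[k] G j) (refl : ∀ i x, t i i le_rfl x = x)
    (comp : ∀ i j l (h : i ≤ j) (h' : j ≤ l) x, t j l h' (t i j h x) = t i l (h.trans h') x)
    (s : ι) (v : G s) (hv : ∀ j (h : j ≤ s), v ∈ LinearMap.range (t j s h)) :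
    ∃ e : ∀ i, G i, e s = v ∧ ∀ i j h, t i j h (e i) = e j := by
  -- Dualizing gives a directed system over the opposite order; finite-dimensionality turns
  -- functionals on the duals back into elements.
  obtain ⟨Φ, hs, hΦ⟩ := exists_compatible_functionals (k := k) (ι := ιᵒᵈ)
    (G := fun i => Module.Dual k (G (OrderDual.ofDual i)))
    (fun i j h => (t (OrderDual.ofDual j) (OrderDual.ofDual i) h).dualMap)
    (fun i g => LinearMap.ext fun x => congrArg g (refl _ x))
    (fun i j l h h' g => LinearMap.ext fun x => congrArg g (comp _ _ _ h' h x))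
    (OrderDual.toDual s) (Module.Dual.eval k _ v) (fun j h g hg => by
      obtain ⟨y, rfl⟩ := hv (OrderDual.ofDual j) h
      exact LinearMap.congr_fun hg y)
  let e (i : ι) : G i := (Module.evalEquiv k (G i)).symm (Φ (OrderDual.toDual i))
  have he (i : ι) (g : Module.Dual k (G i)) : g (e i) = Φ (OrderDual.toDual i) g :=
    Module.apply_evalEquiv_symm_apply k (G i) g _
  refine ⟨e, ?_, fun i j h => ?_⟩
  · refine (Module.evalEquiv k _).injective (LinearMap.ext fun g => ?_)
    exact (he s g).trans (by rw [hs]; rfl)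
  · refine (Module.evalEquiv k _).injective (LinearMap.ext fun g => ?_)
    refine .trans ?_ (he j g).symm
    exact (he i (g ∘ₗ t i j h)).trans (hΦ (OrderDual.toDual j) (OrderDual.toDual i) h g)

/-- A vector and a functional adapted to two flags. -/
theorem exists_adapted {W : Type*} [AddCommGroup W] [Module k W] [Module.Finite k W]
    (𝒜 ℬ : Set (Submodule k W)) (h𝒜 : IsChain (· ≤ ·) 𝒜) (hℬ : IsChain (· ≤ ·) ℬ)
    {I K : Submodule k W} (hI : I ∈ 𝒜) (hK : K ∈ ℬ) (htop : ⊤ ∈ 𝒜) (hKI : ¬ K ≤ I) :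
    ∃ (x : W) (φ : W →ₗ[k] k), φ x = 1 ∧ x ∈ K ∧ x ∉ I ∧
      (∀ A ∈ 𝒜, x ∉ A → ∀ y ∈ A, φ y = 0) ∧ ∀ B ∈ ℬ, x ∉ B → ∀ y ∈ B, φ y = 0 := by
  have le_of {𝒞 : Set (Submodule k W)} (h𝒞 : IsChain (· ≤ ·) 𝒞) {A B} (hA : A ∈ 𝒞) (hB : B ∈ 𝒞)
      (h : ¬ A < B) : B ≤ A := by
    rcases h𝒞.total hA hB with h' | h'
    · exact (h'.lt_or_eq.resolve_left h).ge
    · exact h'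
  -- Choose `B`, then `A`, minimal with `B ⊓ A` not inside `I`, and take `x` there. Members of `ℬ`
  -- missing `x` lie in `I`, and members of `𝒜` missing `x` lie in the predecessor `A'` of `A`,
  -- which contains `I`. A functional killing `A'` but not `x` serves both flags.
  obtain ⟨B, ⟨hB, hBI⟩, hBmin⟩ := wellFounded_lt.has_min {B | B ∈ ℬ ∧ ¬ B ≤ I} ⟨K, hK, hKI⟩
  obtain ⟨A, ⟨hA, hAI⟩, hAmin⟩ := wellFounded_lt.has_min {A | A ∈ 𝒜 ∧ ¬ B ⊓ A ≤ I}
    ⟨⊤, htop, by rwa [inf_top_eq]⟩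
  obtain ⟨x, ⟨hxB, hxA⟩, hxI⟩ := SetLike.not_le_iff_exists.1 hAI
  have hIA : I < A := by
    by_contra h
    exact hxI (le_of h𝒜 hI hA h hxA)
  obtain ⟨A', ⟨hA', hA'A⟩, hmax⟩ := wellFounded_gt.has_min {A' | A' ∈ 𝒜 ∧ A' < A} ⟨I, hI, hIA⟩
  have hxA' : x ∉ A' := fun h => by
    by_contra
    exact hAmin A' ⟨hA', fun hle => hxI (hle ⟨hxB, h⟩)⟩ hA'A
  have hIA' : I ≤ A' := le_of h𝒜 hA' hI (hmax I ⟨hI, hIA⟩)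
  obtain ⟨f, hfx, hf⟩ := A'.exists_le_ker_of_notMem hxA'
  refine ⟨x, (f x)⁻¹ • f, inv_mul_cancel₀ hfx, ?_, hxI, fun C hC hxC y hy => ?_, fun C hC hxC y hy => ?_⟩
  · exact le_of hℬ hK hB (fun h => hBmin K ⟨hK, hKI⟩ h) hxB
  · have hCA : C < A := by
      by_contra h
      exact hxC (le_of h𝒜 hC hA h hxA)
    have : f y = 0 := hf (le_of h𝒜 hA' hC (hmax C ⟨hC, hCA⟩) hy)
    simp [this]
  · have hCB : C < B := by
      by_contra h
      exact hxC (le_of hℬ hC hB h hxB)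
    have hCI : C ≤ I := by
      by_contra h
      exact hBmin C ⟨hC, h⟩ hCB
    have : f y = 0 := hf (hIA' (hCI hy))
    simp [this]

/-- A rank one idempotent endomorphism of a persistence module on a linear order, whose image
is an interval module. -/
theorem exists_interval_idempotent {P : Type*} [LinearOrder P] {G : P → Type*}
    [∀ i, AddCommGroup (G i)] [∀ i, Module k (G i)] [∀ i, Module.Finite k (G i)]
    (t : ∀ i j, i ≤ j → G i →ₗ[k] G j) (refl : ∀ i x, t i i le_rfl x = x)
    (comp : ∀ i j l (h : i ≤ j) (h' : j ≤ l) x, t j l h' (t i j h x) = t i l (h.trans h') x)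
    (s : P) (v : G s) (φ : G s →ₗ[k] k) (hφv : φ v = 1)
    (hrange : ∀ i (h : i ≤ s), v ∉ LinearMap.range (t i s h) → ∀ x, φ (t i s h x) = 0)
    (hker : ∀ j (h : s ≤ j), t s j h v ≠ 0 → ∀ x, t s j h x = 0 → φ x = 0) :
    ∃ (e : ∀ i, G i) (ψ : ∀ i, G i →ₗ[k] k) (L R : Set P), IsUpperSet L ∧ IsLowerSet R ∧
      s ∈ L ∧ s ∈ R ∧ e s = v ∧ ψ s = φ ∧ (∀ i, i ∉ L → e i = 0 ∧ ψ i = 0) ∧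
      (∀ i, i ∉ R → e i = 0 ∧ ψ i = 0) ∧ (∀ i ∈ L, i ∈ R → ψ i (e i) = 1) ∧
      (∀ i j (h : i ≤ j), i ∈ L → t i j h (e i) = e j) ∧
      (∀ i j (h : i ≤ j), j ∈ R → ∀ x, ψ j (t i j h x) = ψ i x) := by
  classical
  have hv0 : v ≠ 0 := fun h => by simp [h] at hφv
  -- The interval is `L ∩ R`: to the left as far as `v` can be lifted, to the right as far as `v`
  -- survives. On `L` the vector extends compatibly, on `R` the functional does, and both are zero
  -- elsewhere.
  let L : Set P := {i | ∀ h : i ≤ s, v ∈ LinearMap.range (t i s h)}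
  let R : Set P := {j | ∀ h : s ≤ j, t s j h v ≠ 0}
  have hL : IsUpperSet L := fun i j hij hi h => by
    obtain ⟨x, hx⟩ := hi (hij.trans h)
    exact ⟨t i j hij x, (comp _ _ _ _ _ _).trans hx⟩
  have hR : IsLowerSet R := fun i j hij hi h h0 => hi (h.trans hij) (by
    rw [← comp _ _ _ h hij, h0, map_zero])
  have hsL : s ∈ L := fun h => ⟨v, refl _ _⟩
  have hsR : s ∈ R := fun h => by rwa [refl]
  obtain ⟨e, hes, he⟩ := exists_compatible_elements (ι := L) (G := fun i => G i)
    (fun i j h => t i j h) (fun i x => refl _ x) (fun i j l h h' x => comp _ _ _ h h' x)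
    ⟨s, hsL⟩ v (fun j h => j.2 h)
  obtain ⟨ψ, hψs, hψ⟩ := exists_compatible_functionals (ι := R) (G := fun i => G i)
    (fun i j h => t i j h) (fun i x => refl _ x) (fun i j l h h' x => comp _ _ _ h h' x)
    ⟨s, hsR⟩ φ (fun j h => hker j h (j.2 h))
  let e' (i : P) : G i := if h : i ∈ L then e ⟨i, h⟩ else 0
  let ψ' (i : P) : G i →ₗ[k] k := if h : i ∈ R then ψ ⟨i, h⟩ else 0
  have he'L {i} (h : i ∈ L) : e' i = e ⟨i, h⟩ := dif_pos h
  have he'0 {i} (h : i ∉ L) : e' i = 0 := dif_neg h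
  have hψ'R {i} (h : i ∈ R) : ψ' i = ψ ⟨i, h⟩ := dif_pos h
  have hψ'0 {i} (h : i ∉ R) : ψ' i = 0 := dif_neg h
  have he's : e' s = v := (he'L hsL).trans hes
  have hψ's : ψ' s = φ := (hψ'R hsR).trans hψs
  have he't (i j) (h : i ≤ j) (hi : i ∈ L) : t i j h (e' i) = e' j := by
    rw [he'L hi, he'L (hL h hi)]
    exact he ⟨i, hi⟩ ⟨j, hL h hi⟩ h
  have hψ't (i j) (h : i ≤ j) (hj : j ∈ R) (x) : ψ' j (t i j h x) = ψ' i x := by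
    rw [hψ'R hj, hψ'R (hR h hj)]
    exact hψ ⟨i, hR h hj⟩ ⟨j, hj⟩ h x
  refine ⟨e', ψ', L, R, hL, hR, hsL, hsR, he's, hψ's, fun i hi => ⟨he'0 hi, ?_⟩,
    fun i hi => ⟨?_, hψ'0 hi⟩, fun i hiL hiR => ?_, he't, hψ't⟩
  · obtain ⟨h, hi'⟩ := not_forall.1 hi
    ext x
    rw [← hψ't i s h hsR, hψ's, hrange i h hi']
    rfl
  · obtain ⟨h, hi'⟩ := not_forall.1 hi
    rw [← he't s i h hsL, he's]
    exact not_not.1 hi'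
  · rcases le_total i s with h | h
    · rw [← hψ't i s h hsR, he't i s h hiL, hψ's, he's, hφv]
    · rw [← he't s i h hsL, hψ't s i h hiR, hψ's, he's, hφv]

end LinearAlgebra

section Thread

variable {k : Type uk} [Field k] {V : Type u} [Quiver.{v} V] {T : ThreadQuiver.{u, v, w} V}

open RepPwf

/-- Linear maps on a thread that vanish at the ends define a morphism of representations. -/
theorem exists_hom_of_thread {M N : RepPwf T k} {a b : V} (α : a ⟶ b)
    (g : ∀ x : T.thread α, M.at (Obj.point α x) →ₗ[k] N.at (Obj.point α x))
    (hthr : ∀ {x y : T.thread α} (h : x ≤ y) m, g y (M.mp (Obj.thr h) m) = N.mp (Obj.thr h) (g x m))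
    (hinn : ∀ x m, g x (M.mp (Obj.inn α x) m) = 0)
    (hout : ∀ x m, N.mp (Obj.out α x) (g x m) = 0) :
    ∃ e : M ⟶ N, (∀ x m, app e (Obj.point α x) m = g x m) ∧
      ∀ X, X ∉ Set.range (Obj.point α) → ∀ m, app e X m = 0 := by
  have hex (X : Obj T) : ∃ G : M.at X →ₗ[k] N.at X,
      (∀ x (h : Obj.point α x = X), G = h ▸ g x) ∧ (X ∉ Set.range (Obj.point α) → G = 0) := by
    by_cases hX : X ∈ Set.range (Obj.point α)
    · obtain ⟨x, rfl⟩ := hX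
      refine ⟨g x, fun x' h => ?_, fun h => (h ⟨x, rfl⟩).elim⟩
      obtain rfl : x' = x := by cases h; rfl
      rfl
    · exact ⟨0, fun x h => (hX ⟨x, h⟩).elim, fun _ => rfl⟩
  choose G hG hG0 using hex
  have hGp (x) : G (Obj.point α x) = g x := hG _ x rfl
  -- A path-like element from a path enters the thread through `inn` and leaves it through `out`, so
  -- both sides of the naturality square vanish on it.
  have hl {X Y : Obj T} (p : Quiver.Path X.exit Y.entry) (m) : G Y (M.mp (.path p : X ⟶ Y) m) = 0 := by
    by_cases hY : Y ∈ Set.range (Obj.point α)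
    · obtain ⟨y, rfl⟩ := hY
      let p' : Quiver.Path X.exit a := p
      have : (.path p : X ⟶ Obj.point α y) = (Obj.toExit X ≫ Obj.ofPath p') ≫ Obj.inn α y :=
        (Obj.path_eq p).trans (Category.assoc _ _ _).symm
      rw [this, ← mp_mp, hGp, hinn]
    · rw [hG0 Y hY]
      rfl
  have hr {X Y : Obj T} (p : Quiver.Path X.exit Y.entry) (m) : N.mp (.path p : X ⟶ Y) (G X m) = 0 := by
    by_cases hX : X ∈ Set.range (Obj.point α)
    · obtain ⟨x, rfl⟩ := hX
      let p' : Quiver.Path b Y.entry := p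
      have : (.path p : Obj.point α x ⟶ Y) = Obj.out α x ≫ Obj.ofPath p' ≫ Obj.fromEntry Y :=
        Obj.path_eq p
      rw [this, ← mp_mp, hGp, hout, map_zero]
    · rw [hG0 X hX]
      exact map_zero _
  refine ⟨homMk G (fun {X Y} f m => ?_), fun x m => ?_, fun X hX m => ?_⟩
  · change PathLike X Y at f
    cases f with
    | path p => exact (hl p m).trans (hr p m).symm
    | @thread a' b' β x y h =>
      by_cases hx : Obj.point β x ∈ Set.range (Obj.point α)
      · obtain ⟨z, hz⟩ := hx
        cases hz
        rw [hGp, hGp]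
        exact hthr h m
      · have hy : Obj.point β y ∉ Set.range (Obj.point α) := by
          rintro ⟨z, hz⟩
          cases hz
          exact hx ⟨x, rfl⟩
        rw [hG0 _ hx, hG0 _ hy]
        exact (map_zero _).symm
  · rw [app_homMk, hGp]
  · rw [app_homMk, hG0 X hX]
    rfl

end Thread

end ThreadQuiver

/-! ### Splitting off interval representations -/

namespace ThreadQuiver

section Summands

/-- An idempotent endomorphism decomposes an object of an abelian category. -/
theorem exists_biprod_of_idempotent {A : Type*} [Category A] [Abelian A] {M : A} (e : M ⟶ M)
    (he : e ≫ e = e) : ∃ (J J' : A) (i : J ⟶ M) (p : M ⟶ J) (i' : J' ⟶ M) (p' : M ⟶ J'),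
      i ≫ p = 𝟙 J ∧ p ≫ i = e ∧ i' ≫ p' = 𝟙 J' ∧ p' ≫ i' = 𝟙 M - e ∧ Nonempty (M ≅ J ⊞ J') := by
  obtain ⟨J, i, p, h₁, h₂⟩ := IsIdempotentComplete.idempotents_split M e he
  obtain ⟨J', i', p', h₁', h₂'⟩ := IsIdempotentComplete.idempotents_split M (𝟙 M - e)
    (by simp [Preadditive.sub_comp, Preadditive.comp_sub, he])
  have hip' : i ≫ p' = 0 := by
    have : (i ≫ p ≫ i) ≫ (p' ≫ i') ≫ p' = 0 := by
      rw [h₂, h₂']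
      simp [Preadditive.sub_comp, Preadditive.comp_sub, reassoc_of% he]
    simpa [reassoc_of% h₁, h₁'] using this
  have hi'p : i' ≫ p = 0 := by
    have : (i' ≫ p' ≫ i') ≫ (p ≫ i) ≫ p = 0 := by
      rw [h₂, h₂']
      simp [Preadditive.sub_comp, Preadditive.comp_sub, reassoc_of% he]
    simpa [reassoc_of% h₁', h₁] using this
  refine ⟨J, J', i, p, i', p', h₁, h₂, h₁', h₂', ⟨⟨biprod.lift p p', biprod.desc i i', ?_, ?_⟩⟩⟩
  · rw [biprod.lift_desc, h₂, h₂', add_sub_cancel]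
  · ext <;> simp [h₁, h₁', hip', hi'p]

variable {k : Type uk} [Field k] {V : Type u} [Quiver.{v} V] {T : ThreadQuiver.{u, v, w} V}

open RepPwf

theorem subsingleton_of_retract {M L : RepPwf T k} (i : L ⟶ M) (r : M ⟶ L) (h : i ≫ r = 𝟙 L)
    {X : Obj T} (hM : Subsingleton (M.at X)) : Subsingleton (L.at X) := by
  refine ⟨fun m m' => ?_⟩
  have hir (m : L.at X) : app r X (app i X m) = m := congrArg (fun ψ => app ψ X m) h
  rw [← hir m, ← hir m', hM.elim (app i X m) (app i X m')]

theorem notMem_support {M : RepPwf T k} {X : Obj T} : X ∉ M.support ↔ Subsingleton (M.at X) :=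
  not_nontrivial_iff_subsingleton

/-- Interval representations in a thread are indecomposable and tame. -/
theorem indecomposable_of_interval {J : RepPwf T k} {a b : V} (α : a ⟶ b)
    {L R : Set (T.thread α)} (hL : IsUpperSet L) (hR : IsLowerSet R) {s : T.thread α} (hsL : s ∈ L)
    (hsR : s ∈ R) (l : ∀ x, J.at (Obj.point α x) →ₗ[k] k)
    (hbij : ∀ x ∈ L, x ∈ R → Function.Bijective (l x))
    (hl : ∀ {x y} (h : x ≤ y), y ∈ R → ∀ m, l y (J.mp (Obj.thr h) m) = l x m)
    (hzero : ∀ X ∉ Set.range (Obj.point α), Subsingleton (J.at X))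
    (hzero' : ∀ x, x ∉ L ∨ x ∉ R → Subsingleton (J.at (Obj.point α x))) :
    Indecomposable J ∧ IsTameOn J α := by
  classical
  have hmp {x y : T.thread α} (h : x ≤ y) (hx : x ∈ L) (hy : y ∈ R) :
      Function.Bijective (J.mp (Obj.thr h)) := by
    rw [← (hbij y (hL h hx) hy).of_comp_iff' (J.mp (Obj.thr h))]
    have : (l y) ∘ (J.mp (Obj.thr h)) = l x := funext fun m => hl h hy m
    rw [this]
    exact hbij x hx (hR h hy)
  -- Transition maps of a retract are bijective along the interval, so a direct summand that
  -- vanishes at `s` vanishes altogether.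
  have hsub {Y : RepPwf T k} (i : Y ⟶ J) (r : J ⟶ Y) (hir : i ≫ r = 𝟙 Y)
      (hY : Subsingleton (Y.at (Obj.point α s))) : IsZero Y := by
    refine isZero_iff.2 fun X => ?_
    by_cases hX : X ∈ Set.range (Obj.point α)
    · obtain ⟨x, rfl⟩ := hX
      by_cases hx : x ∈ L ∧ x ∈ R
      · rcases le_total x s with h | h
        · exact (bijective_mp_of_retract i r hir (hmp h hx.1 hsR)).1.subsingleton
        · exact (bijective_mp_of_retract i r hir (hmp h hsL hx.2)).2.subsingleton
      · exact subsingleton_of_retract i r hir (hzero' x (not_and_or.1 hx))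
    · exact subsingleton_of_retract i r hir (hzero X hX)
  refine ⟨⟨fun h => ?_, fun Y Z e => ?_⟩, ?_⟩
  · have := isZero_iff.1 h (Obj.point α s)
    have := (hbij s hsL hsR).2.subsingleton
    exact not_subsingleton k this
  · have hY : (biprod.inl ≫ e.inv) ≫ e.hom ≫ biprod.fst = 𝟙 Y := by simp
    have hZ : (biprod.inr ≫ e.inv) ≫ e.hom ≫ biprod.snd = 𝟙 Z := by simp
    have hZY : (biprod.inr ≫ e.inv) ≫ e.hom ≫ biprod.fst = (0 : Z ⟶ Y) := by simp
    by_contra! hcon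
    have hYs : ¬ Subsingleton (Y.at (Obj.point α s)) := fun h => hcon.1 (hsub _ _ hY h)
    have hZs : ¬ Subsingleton (Z.at (Obj.point α s)) := fun h => hcon.2 (hsub _ _ hZ h)
    rw [not_subsingleton_iff_nontrivial] at hYs hZs
    obtain ⟨y, hy⟩ := exists_ne (0 : Y.at (Obj.point α s))
    obtain ⟨z, hz⟩ := exists_ne (0 : Z.at (Obj.point α s))
    have hY' := congrArg (fun ψ => app ψ (Obj.point α s) y) hY
    have hZ' := congrArg (fun ψ => app ψ (Obj.point α s) z) hZ
    have hZY' := congrArg (fun ψ => app ψ (Obj.point α s) z) hZY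
    simp only [app_id, app_zero] at hY' hZ' hZY'
    rw [app_comp (biprod.inl ≫ e.inv)] at hY'
    rw [app_comp (biprod.inr ≫ e.inv)] at hZ' hZY'
    set y' := app (biprod.inl ≫ e.inv) (Obj.point α s) y
    set z' := app (biprod.inr ≫ e.inv) (Obj.point α s) z
    have hd : l s z' ≠ 0 := fun h => hz (by
      rw [← hZ', (hbij s hsL hsR).1 (h.trans (map_zero _).symm), map_zero])
    -- Two vectors in a one-dimensional space are proportional; projecting this relation to `Y`
    -- kills `z'` but not `y'`.
    have : l s z' • y' = l s y' • z' := (hbij s hsL hsR).1 (by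
      rw [map_smul, map_smul, smul_eq_mul, smul_eq_mul, mul_comm])
    have := congrArg (app (e.hom ≫ biprod.fst) (Obj.point α s)) this
    rw [map_smul, map_smul, hY', hZY', smul_zero] at this
    exact (smul_ne_zero hd hy) this
  -- The values 0, 1 and 2 mark the points before, in and after the interval.
  · refine ⟨fun x => if x ∈ L then (if x ∈ R then 1 else 2) else 0, 2, fun x y hxy => ?_,
      fun x => ?_, fun {x y} hxy h => ?_⟩
    · by_cases hx : x ∈ L
      · have hy := hL hxy hx
        by_cases hy' : y ∈ R
        · simp [hx, hy, hy', hR hxy hy']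
        · simp only [hx, hy, hy', if_true, if_false]
          split_ifs <;> norm_num
      · simp [hx]
    · dsimp only
      split_ifs <;> norm_num
    · dsimp only at h
      have hz (hx : x ∉ L ∨ x ∉ R) (hy : y ∉ L ∨ y ∉ R) : Function.Bijective (J.mp (Obj.thr hxy)) := by
        have := hzero' x hx
        have := hzero' y hy
        exact ⟨fun _ _ _ => Subsingleton.elim _ _, fun _ => ⟨0, Subsingleton.elim _ _⟩⟩
      by_cases hx : x ∈ L <;> by_cases hx' : x ∈ R <;> by_cases hy : y ∈ L <;>
        by_cases hy' : y ∈ R <;> simp [hx, hx', hy, hy'] at h <;>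
        first | exact hmp hxy hx hy' | exact hz (by tauto) (by tauto)

/-- A representation with a vector at a point of a thread that is killed at the end of the thread
and does not come from the beginning of the thread has an interval representation as a direct
summand. -/
theorem exists_interval_summand (M : RepPwf T k) {a b : V} (α : a ⟶ b) (s : T.thread α)
    (hs : ¬ LinearMap.ker (M.mp (Obj.out α s)) ≤ LinearMap.range (M.mp (Obj.inn α s))) :
    ∃ J J' : RepPwf T k, Nonempty (M ≅ J ⊞ J') ∧ Indecomposable J ∧ IsTameOn J α ∧
      J.support ⊆ Set.range (Obj.point α) ∧ Nontrivial (J.at (Obj.point α s)) := by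
  have hinn {x y : T.thread α} (h : x ≤ y) (m) :
      M.mp (Obj.thr h) (M.mp (Obj.inn α x) m) = M.mp (Obj.inn α y) m := mp_mp _ _ _
  have hout {x y : T.thread α} (h : x ≤ y) (m) :
      M.mp (Obj.out α y) (M.mp (Obj.thr h) m) = M.mp (Obj.out α x) m := mp_mp _ _ _
  have hthr {x y z : T.thread α} (h : x ≤ y) (h' : y ≤ z) (m) :
      M.mp (Obj.thr h') (M.mp (Obj.thr h) m) = M.mp (Obj.thr (h.trans h')) m := mp_mp _ _ _
  have hrefl (x : T.thread α) (m) : M.mp (Obj.thr (le_refl x)) m = m := LinearMap.congr_fun mp_id m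
  let 𝒜 : Set (Submodule k (M.at (Obj.point α s))) :=
    {A | (∃ x, ∃ h : x ≤ s, A = LinearMap.range (M.mp (Obj.thr h))) ∨
      A = LinearMap.range (M.mp (Obj.inn α s))}
  let ℬ : Set (Submodule k (M.at (Obj.point α s))) :=
    {B | (∃ x, ∃ h : s ≤ x, B = LinearMap.ker (M.mp (Obj.thr h))) ∨
      B = LinearMap.ker (M.mp (Obj.out α s))}
  have hinn_le {x} (h : x ≤ s) :
      LinearMap.range (M.mp (Obj.inn α s)) ≤ LinearMap.range (M.mp (Obj.thr h)) := by
    rintro _ ⟨m, rfl⟩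
    exact ⟨_, hinn h m⟩
  have hle_out {x} (h : s ≤ x) :
      LinearMap.ker (M.mp (Obj.thr h)) ≤ LinearMap.ker (M.mp (Obj.out α s)) := fun m hm => by
    rw [LinearMap.mem_ker] at hm ⊢
    rw [← hout h, hm, map_zero]
  have hrange_le {x y} (h : x ≤ y) (hy : y ≤ s) :
      LinearMap.range (M.mp (Obj.thr (h.trans hy))) ≤ LinearMap.range (M.mp (Obj.thr hy)) := by
    rintro _ ⟨m, rfl⟩
    exact ⟨_, hthr h hy m⟩
  have hker_le {x y} (h : s ≤ x) (h' : x ≤ y) :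
      LinearMap.ker (M.mp (Obj.thr h)) ≤ LinearMap.ker (M.mp (Obj.thr (h.trans h'))) := fun m hm => by
    rw [LinearMap.mem_ker] at hm ⊢
    rw [← hthr h h', hm, map_zero]
  have h𝒜 : IsChain (· ≤ ·) 𝒜 := by
    rintro A (⟨x, hx, rfl⟩ | rfl) B (⟨y, hy, rfl⟩ | rfl) -
    · exact (le_total x y).imp (fun h => hrange_le h hy) (fun h => hrange_le h hx)
    · exact Or.inr (hinn_le hx)
    · exact Or.inl (hinn_le hy)
    · exact Or.inl le_rfl
  have hℬ : IsChain (· ≤ ·) ℬ := by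
    rintro A (⟨x, hx, rfl⟩ | rfl) B (⟨y, hy, rfl⟩ | rfl) -
    · exact (le_total x y).imp (fun h => hker_le hx h) (fun h => hker_le hy h)
    · exact Or.inl (hle_out hx)
    · exact Or.inr (hle_out hy)
    · exact Or.inl le_rfl
  -- Including the image of `inn` and the kernel of `out` in the flags makes `φ` vanish on
  -- everything from the source, while `v` dies at the target. Thus the idempotent `ψ ⊗ e` extends
  -- by zero off the thread.
  obtain ⟨v, φ, hφv, hvK, hvI, hφ𝒜, hφℬ⟩ := exists_adapted 𝒜 ℬ h𝒜 hℬ (Or.inr rfl) (Or.inr rfl)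
    (Or.inl ⟨s, le_rfl, (LinearMap.range_eq_top.2 fun m => ⟨m, hrefl s m⟩).symm⟩) hs
  have hφI (m) : φ (M.mp (Obj.inn α s) m) = 0 := hφ𝒜 _ (Or.inr rfl) hvI _ ⟨m, rfl⟩
  obtain ⟨e, ψ, L, R, hL, hR, hsL, hsR, hes, hψs, hL0, hR0, hψe, he, hψ⟩ :=
    exists_interval_idempotent (G := fun x : T.thread α => M.at (Obj.point α x))
      (fun x y h => M.mp (Obj.thr h)) hrefl (fun _ _ _ h h' => hthr h h') s v φ hφv
      (fun x h hv m => hφ𝒜 _ (Or.inl ⟨x, h, rfl⟩) hv _ ⟨m, rfl⟩)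
      (fun x h hv m hm => hφℬ _ (Or.inl ⟨x, h, rfl⟩) hv m hm)
  obtain ⟨E, hE, hE0⟩ := exists_hom_of_thread (M := M) (N := M) α
    (fun x => LinearMap.smulRight (ψ x) (e x)) (fun {x y} h m => by
      simp only [LinearMap.smulRight_apply, map_smul]
      by_cases hx : x ∈ L
      · rw [he x y h hx]
        by_cases hy : y ∈ R
        · rw [hψ x y h hy]
        · rw [(hR0 y hy).1, smul_zero, smul_zero]
      · rw [(hL0 x hx).1, (hL0 x hx).2, map_zero, smul_zero]
        by_cases hy : y ∈ R
        · rw [hψ x y h hy, (hL0 x hx).2, LinearMap.zero_apply, zero_smul]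
        · rw [(hR0 y hy).1, smul_zero])
    (fun x m => by
      simp only [LinearMap.smulRight_apply]
      by_cases hx : x ∈ R
      · rcases le_total x s with h | h
        · rw [← hψ x s h hsR, hinn, hψs, hφI, zero_smul]
        · rw [← hinn h, hψ s x h hx, hψs, hφI, zero_smul]
      · rw [(hR0 x hx).1, smul_zero])
    (fun x m => by
      simp only [LinearMap.smulRight_apply, map_smul]
      by_cases hx : x ∈ L
      · rcases le_total x s with h | h
        · rw [← hout h, he x s h hx, hes, LinearMap.mem_ker.1 hvK, smul_zero]
        · rw [← he s x h hsL, hout h, hes, LinearMap.mem_ker.1 hvK, smul_zero]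
      · rw [(hL0 x hx).1, map_zero, smul_zero])
  simp only [LinearMap.smulRight_apply] at hE
  have hEE : E ≫ E = E := hom_ext fun X m => by
    rw [app_comp]
    by_cases hX : X ∈ Set.range (Obj.point α)
    · obtain ⟨x, rfl⟩ := hX
      rw [hE, hE, map_smul, smul_eq_mul]
      by_cases hxL : x ∈ L
      · by_cases hxR : x ∈ R
        · rw [hψe x hxL hxR, mul_one]
        · rw [(hR0 x hxR).1, smul_zero, smul_zero]
      · rw [(hL0 x hxL).1, smul_zero, smul_zero]
    · rw [hE0 X hX, hE0 X hX]
  obtain ⟨J, J', i, p, -, -, hip, hpi, -, -, hJ⟩ := exists_biprod_of_idempotent E hEE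
  have hip' (X) (j : J.at X) : app p X (app i X j) = j := congrArg (fun ψ => app ψ X j) hip
  have hpi' (X) (m : M.at X) : app i X (app p X m) = app E X m := congrArg (fun ψ => app ψ X m) hpi
  have hEi (X) (j : J.at X) : app E X (app i X j) = app i X j := by rw [← hpi', hip']
  have hsub (X : Obj T) (h : ∀ m, app E X m = 0) : Subsingleton (J.at X) := by
    refine subsingleton_of_forall_eq 0 fun j => ?_
    rw [← hip' X j, ← hEi, h, map_zero]
  have hzero : ∀ X ∉ Set.range (Obj.point α), Subsingleton (J.at X) :=
    fun X hX => hsub X (hE0 X hX)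
  have hbij (x) (hxL : x ∈ L) (hxR : x ∈ R) :
      Function.Bijective (ψ x ∘ₗ app i (Obj.point α x)) := by
    refine ⟨(injective_iff_map_eq_zero _).2 fun j hj => ?_, fun c => ?_⟩
    · rw [← hip' _ j, ← hEi, hE]
      change app p _ ((ψ x ∘ₗ app i (Obj.point α x)) j • e x) = 0
      rw [hj, zero_smul, map_zero]
    · refine ⟨app p _ (c • e x), ?_⟩
      rw [LinearMap.comp_apply, hpi', hE, map_smul, map_smul, hψe x hxL hxR]
      simp
  obtain ⟨h₁, h₂⟩ := indecomposable_of_interval α hL hR hsL hsR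
    (fun x => ψ x ∘ₗ app i (Obj.point α x)) hbij
    (fun {x y} h hy j => by
      rw [LinearMap.comp_apply, app_mp, hψ x y h hy]
      rfl) hzero
    (fun x hx => hsub _ fun m => by
      rw [hE]
      rcases hx with hx | hx
      · rw [(hL0 x hx).1, smul_zero]
      · rw [(hR0 x hx).1, smul_zero])
  refine ⟨J, J', hJ, h₁, h₂, fun X hX => ?_, ?_⟩
  · by_contra h
    exact notMem_support.2 (hzero X h) hX
  · by_contra h
    rw [not_nontrivial_iff_subsingleton] at h
    exact not_subsingleton k (hbij s hsL hsR).2.subsingleton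

end Summands

end ThreadQuiver

/-! ### Quasi noise free representations are tame -/

namespace ThreadQuiver

section QuasiNoiseFree

variable {k : Type uk} [Field k] {V : Type u} [Quiver.{v} V] {T : ThreadQuiver.{u, v, w} V}

open RepPwf

variable {M N U : RepPwf T k} {a b : V} {α : a ⟶ b}

theorem IsNoise.subsingleton (hM : IsNoise M) (a : V) : Subsingleton (M.at (Obj.vertex a)) :=
  notMem_support.1 fun h => Set.disjoint_left.1 hM h ⟨a, rfl⟩

theorem vertex_notMem_range {c : V} :
    (Obj.vertex c : Obj T) ∉ Set.range (Obj.point α) := by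
  rintro ⟨x, hx⟩
  cases hx

theorem isNoise_of_support (hU : U.support ⊆ Set.range (Obj.point α)) : IsNoise U := by
  refine Set.disjoint_left.2 fun X hX => ?_
  rintro ⟨c, rfl⟩
  exact vertex_notMem_range (hU hX)

/-- Along the thread the rank of `inn` decreases and that of `out` increases. Where both are
constant, a vector killed by a transition lies in the image of `inn`, on which the transition is
injective by rank; and any target vector is reached up to the image of `inn`, which is hit as well.
-/
theorem isTameOn_of_ker_le_range
    (h : ∀ x, LinearMap.ker (M.mp (Obj.out α x)) ≤ LinearMap.range (M.mp (Obj.inn α x))) :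
    IsTameOn M α := by
  have hinn {x y : T.thread α} (h : x ≤ y) (m) :
      M.mp (Obj.thr h) (M.mp (Obj.inn α x) m) = M.mp (Obj.inn α y) m := mp_mp _ _ _
  have hout {x y : T.thread α} (h : x ≤ y) (m) :
      M.mp (Obj.out α y) (M.mp (Obj.thr h) m) = M.mp (Obj.out α x) m := mp_mp _ _ _
  let i (x : T.thread α) : ℕ := Module.finrank k (LinearMap.range (M.mp (Obj.inn α x)))
  let o (x : T.thread α) : ℕ := Module.finrank k (LinearMap.range (M.mp (Obj.out α x)))
  have hmap {x y : T.thread α} (h : x ≤ y) : LinearMap.range (M.mp (Obj.inn α y)) =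
      (LinearMap.range (M.mp (Obj.inn α x))).map (M.mp (Obj.thr h)) := by
    rw [← LinearMap.range_comp]
    exact congrArg LinearMap.range (LinearMap.ext fun m => (hinn h m).symm)
  have hle {x y : T.thread α} (h : x ≤ y) :
      LinearMap.range (M.mp (Obj.out α x)) ≤ LinearMap.range (M.mp (Obj.out α y)) := by
    rintro _ ⟨m, rfl⟩
    exact ⟨_, hout h m⟩
  have hi {x y : T.thread α} (h : x ≤ y) : i y ≤ i x := by
    change Module.finrank k (LinearMap.range (M.mp (Obj.inn α y))) ≤ _
    rw [hmap h]
    exact Submodule.finrank_map_le _ _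
  have ho {x y : T.thread α} (h : x ≤ y) : o x ≤ o y := Submodule.finrank_mono (hle h)
  have hi' (x : T.thread α) : i x ≤ Module.finrank k (M.at (Obj.vertex a)) :=
    LinearMap.finrank_range_le _
  have ho' (x : T.thread α) : o x ≤ Module.finrank k (M.at (Obj.vertex b)) :=
    Submodule.finrank_le _
  -- Subtracting from the dimension at the source makes the second term increasing; the bound `hi'`
  -- keeps the subtraction of natural numbers from truncating.
  refine ⟨fun x => o x + (Module.finrank k (M.at (Obj.vertex a)) - i x),
    Module.finrank k (M.at (Obj.vertex b)) + Module.finrank k (M.at (Obj.vertex a)),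
    fun x y hxy => ?_, fun x => ?_, fun {x y} hxy hf => ?_⟩
  · have := hi hxy
    have := ho hxy
    dsimp only
    omega
  · have := ho' x
    dsimp only
    omega
  · have h₁ := hi hxy
    have h₂ := ho hxy
    have h₃ := hi' x
    dsimp only at hf
    have hieq : i x = i y := by omega
    have hoeq : o x = o y := by omega
    refine ⟨(injective_iff_map_eq_zero _).2 fun m hm => ?_, fun m => ?_⟩
    · have hmr : m ∈ LinearMap.range (M.mp (Obj.inn α x)) := h x (by
        rw [LinearMap.mem_ker, ← hout hxy, hm, map_zero])
      have hsurj : Function.Surjective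
          ((M.mp (Obj.thr hxy)).restrict (p := LinearMap.range (M.mp (Obj.inn α x)))
            (q := LinearMap.range (M.mp (Obj.inn α y))) (by
              rintro _ ⟨n, rfl⟩
              exact ⟨n, (hinn hxy n).symm⟩)) := by
        rintro ⟨_, n, rfl⟩
        exact ⟨⟨_, n, rfl⟩, Subtype.ext (hinn hxy n)⟩
      have hinj := (LinearMap.injective_iff_surjective_of_finrank_eq_finrank hieq).2 hsurj
      have := @hinj ⟨m, hmr⟩ 0 (Subtype.ext (by simpa using hm))
      exact congrArg Subtype.val this
    · have hr := Submodule.eq_of_le_of_finrank_eq (hle hxy) hoeq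
      obtain ⟨n, hn⟩ : M.mp (Obj.out α y) m ∈ LinearMap.range (M.mp (Obj.out α x)) := by
        rw [hr]
        exact ⟨m, rfl⟩
      obtain ⟨l, hl⟩ : m - M.mp (Obj.thr hxy) n ∈ LinearMap.range (M.mp (Obj.inn α y)) := h y (by
        rw [LinearMap.mem_ker, map_sub, hout, hn, sub_self])
      refine ⟨M.mp (Obj.inn α x) l + n, ?_⟩
      rw [map_add, hinn, hl, sub_add_cancel]

theorem IsNoiseFree.ker_le_range (hM : IsNoiseFree M) (α : a ⟶ b) (x : T.thread α) :
    LinearMap.ker (M.mp (Obj.out α x)) ≤ LinearMap.range (M.mp (Obj.inn α x)) := by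
  by_contra h
  obtain ⟨J, J', e, hJ, -, hs, -⟩ := exists_interval_summand M α x h
  exact hJ.1 (hM J ⟨J', e⟩ (isNoise_of_support hs))

/-- Elements of a noise summand die at the target, so they come from the source, where the summand
is zero. Together with `IsNoiseFree.ker_le_range` this characterizes noise free representations. -/
theorem isNoiseFree_of_ker_le_range (hM : ∀ {a b : V} (α : a ⟶ b) (x : T.thread α),
    LinearMap.ker (M.mp (Obj.out α x)) ≤ LinearMap.range (M.mp (Obj.inn α x))) :
    IsNoiseFree M := by
  rintro N ⟨N', ⟨e⟩⟩ hN
  have hir : (biprod.inl ≫ e.inv) ≫ e.hom ≫ biprod.fst = 𝟙 N := by simp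
  generalize biprod.inl ≫ e.inv = i, e.hom ≫ biprod.fst = r at hir
  refine isZero_iff.2 fun X => ?_
  cases X with
  | vertex c => exact hN.subsingleton c
  | @point a b α x =>
    have ha := hN.subsingleton a
    have hb := hN.subsingleton b
    refine subsingleton_of_forall_eq 0 fun m => ?_
    have hm : app r (Obj.point α x) (app i (Obj.point α x) m) = m :=
      congrArg (fun ψ => app ψ _ m) hir
    obtain ⟨l, hl⟩ := hM α x (show app i (Obj.point α x) m ∈ _ by
      rw [LinearMap.mem_ker, ← app_mp, hb.elim (N.mp (Obj.out α x) m) 0, map_zero])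
    rw [← hm, ← hl, app_mp, ha.elim (app r _ l) 0, map_zero]

/-- An indecomposable representation supported in a thread is tame. -/
theorem isTameOn_of_indecomposable (hU : Indecomposable U)
    (hs : U.support ⊆ Set.range (Obj.point α)) : IsTameOn U α := by
  by_cases h : ∀ x : T.thread α, Subsingleton (U.at (Obj.point α x))
  · exact IsTameOn.of_subsingleton h
  · push Not at h
    obtain ⟨x, hx⟩ := h
    have ha := (isNoise_of_support hs).subsingleton a
    have hb := (isNoise_of_support hs).subsingleton b
    obtain ⟨m, hm⟩ := exists_ne (0 : U.at (Obj.point α x))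
    -- `U` vanishes at both ends, so any nonzero vector on the thread yields an interval summand,
    -- which must be all of `U`.
    obtain ⟨J, J', ⟨e⟩, hJ, hJt, -⟩ := exists_interval_summand U α x fun hle => by
      obtain ⟨l, hl⟩ := hle (show m ∈ _ from hb.elim _ _)
      exact hm (by rw [← hl, ha.elim l 0, map_zero])
    have hJ' : IsZero J' := (hU.2 J J' e).resolve_left hJ.1
    exact (hJt.biprod (IsTameOn.of_subsingleton fun _ => isZero_iff.1 hJ' _)).of_iso e.symm

theorem isTameOn_of_isFiniteSum (hU : IsFiniteSumOfIndecomposables U)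
    (hs : U.support ⊆ Set.range (Obj.point α)) : IsTameOn U α := by
  obtain ⟨n, X, hX, ⟨e⟩⟩ := hU
  refine (IsTameOn.biproduct fun i => isTameOn_of_indecomposable (hX i) fun Y hY => ?_).of_iso e.symm
  by_contra hYα
  refine notMem_support.2 (subsingleton_of_retract (biproduct.ι X i ≫ e.inv)
    (e.hom ≫ biproduct.π X i) (by simp) (notMem_support.1 fun h => hYα (hs h))) hY

/-- The coproduct is only known by its universal property, not pointwise. The universal property
identifies the cut-off of `D.N` to the thread of `α` with the projection to `D.U α` followed by its
inclusion, so on this thread `D.N` is a retract of `D.U α`. -/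
theorem NoiseDecomposition.isTameOn (D : NoiseDecomposition M) (α : a ⟶ b)
    (hU : IsTameOn (D.U ⟨a, b, α⟩) α) : IsTameOn D.N α := by
  classical
  have hD := D.isCoproduct
  have ha := D.noise.subsingleton a
  have hb := D.noise.subsingleton b
  let c : ∀ β, D.U β ⟶ D.U ⟨a, b, α⟩ := Pi.single ⟨a, b, α⟩ (𝟙 _)
  let π : D.N ⟶ D.U ⟨a, b, α⟩ := hD.desc (Cofan.mk _ c)
  have hπ (β) : D.ι β ≫ π = c β := hD.fac (Cofan.mk _ c) ⟨β⟩
  obtain ⟨e, he, he0⟩ := exists_hom_of_thread (M := D.N) (N := D.N) α (fun _ => LinearMap.id)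
    (fun _ _ => rfl) (fun x m => by rw [ha.elim m 0, map_zero, map_zero]) (fun x m => hb.elim _ _)
  have hπe : π ≫ D.ι _ = e := hD.hom_ext fun ⟨β⟩ => by
    change D.ι β ≫ π ≫ D.ι _ = D.ι β ≫ e
    rw [← Category.assoc, hπ]
    have hβ (hX : ∀ X ∉ Set.range (Obj.point α), Subsingleton ((D.U β).at X)) :
        D.ι β = D.ι β ≫ e := hom_ext fun X m => by
      rw [app_comp]
      by_cases h : X ∈ Set.range (Obj.point α)
      · obtain ⟨x, rfl⟩ := h
        exact (he x _).symm
      · rw [(hX X h).elim m 0, map_zero, map_zero]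
    by_cases h : β = ⟨a, b, α⟩
    · subst h
      have : c ⟨a, b, α⟩ = 𝟙 _ := Pi.single_eq_same _ _
      rw [this, Category.id_comp]
      exact hβ fun X hX => notMem_support.1 fun h => hX (D.support_U α h)
    · have : c β = 0 := Pi.single_eq_of_ne h _
      rw [this, zero_comp]
      refine hom_ext fun X m => ?_
      rw [app_comp, app_zero]
      by_cases hX : X ∈ Set.range (Obj.point α)
      · obtain ⟨x, rfl⟩ := hX
        have : Subsingleton ((D.U β).at (Obj.point α x)) := notMem_support.1 fun hm => by
          obtain ⟨a', b', β⟩ := β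
          obtain ⟨y, hy⟩ := D.support_U β hm
          cases hy
          exact h rfl
        rw [this.elim m 0, map_zero, map_zero]
      · exact (he0 X hX _).symm
  have hπι (x) (m : D.N.at (Obj.point α x)) : app (D.ι _) _ (app π _ m) = m :=
    (congrArg (fun ψ => app ψ (Obj.point α x) m) hπe).trans (he x m)
  refine hU.of_bijective fun {x y} h hxy => ⟨fun m m' hm => ?_, fun m => ?_⟩
  · have := congrArg (app π _) hm
    rw [app_mp, app_mp] at this
    rw [← hπι x m, hxy.1 this, hπι]
  · obtain ⟨l, hl⟩ := hxy.2 (app π _ m)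
    exact ⟨app (D.ι _) _ l, by rw [← app_mp, hl, hπι]⟩

theorem IsQuasiNoiseFree.isTameOn (hM : IsQuasiNoiseFree M) (α : a ⟶ b) : IsTameOn M α := by
  obtain ⟨D, hD⟩ := hM
  exact ((isTameOn_of_ker_le_range (D.noiseFree.ker_le_range α)).biprod
    (D.isTameOn α (isTameOn_of_isFiniteSum (hD _) (D.support_U α)))).of_iso D.iso.symm

theorem isFiniteSum_of_isZero (hU : IsZero U) : IsFiniteSumOfIndecomposables U :=
  ⟨0, Fin.elim0, fun i => i.elim0, ⟨hU.iso ((IsZero.iff_id_eq_zero _).2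
    (biproduct.hom_ext _ _ fun i => i.elim0))⟩⟩

theorem isFiniteSum_biprod (hM : Indecomposable M) (hU : IsFiniteSumOfIndecomposables U) :
    IsFiniteSumOfIndecomposables (M ⊞ U) := by
  obtain ⟨n, X, hX, ⟨e⟩⟩ := hU
  let Y : Fin (n + 1) → RepPwf T k := Fin.cons M X
  let j₀ : M ⟶ ⨁ Y := biproduct.ι Y 0
  let p₀ : (⨁ Y) ⟶ M := biproduct.π Y 0
  let j (i : Fin n) : X i ⟶ ⨁ Y := biproduct.ι Y i.succ
  let p (i : Fin n) : (⨁ Y) ⟶ X i := biproduct.π Y i.succ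
  have h₀₀ : j₀ ≫ p₀ = 𝟙 M := biproduct.ι_π_self Y 0
  have h₀ (i) : j₀ ≫ p i = 0 := biproduct.ι_π_ne Y (Fin.succ_ne_zero i).symm
  have h₀' (i) : j i ≫ p₀ = 0 := biproduct.ι_π_ne Y (Fin.succ_ne_zero i)
  have hself (i) : j i ≫ p i = 𝟙 (X i) := biproduct.ι_π_self Y i.succ
  have hne {i i'} (h : i ≠ i') : j i ≫ p i' = 0 :=
    biproduct.ι_π_ne Y fun h' => h (Fin.succ_injective _ h')
  have htot : p₀ ≫ j₀ + ∑ i, p i ≫ j i = 𝟙 (⨁ Y) := by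
    rw [← biproduct.total]
    exact (Fin.sum_univ_succ fun i => biproduct.π Y i ≫ biproduct.ι Y i).symm
  let f : (⨁ Y) ⟶ M ⊞ ⨁ X := biprod.lift p₀ (biproduct.lift p)
  let g : M ⊞ (⨁ X) ⟶ ⨁ Y := biprod.desc j₀ (biproduct.desc j)
  have hfg : f ≫ g = 𝟙 _ := by
    rw [biprod.lift_desc, biproduct.lift_desc, htot]
  have hgf : g ≫ f = 𝟙 _ := by
    refine biprod.hom_ext' _ _ ?_ (biproduct.hom_ext' _ _ fun i => ?_)
    · refine biprod.hom_ext _ _ ?_ (biproduct.hom_ext _ _ fun i' => ?_)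
      · simp [f, g, h₀₀]
      · simp [f, g, h₀]
    · refine biprod.hom_ext _ _ ?_ (biproduct.hom_ext _ _ fun i' => ?_)
      · simp [f, g, h₀']
      · by_cases h : i = i'
        · subst h
          simp [f, g, hself]
        · simp [f, g, hne h, biproduct.ι_π_ne X h]
  exact ⟨n + 1, Y, Fin.cases hM hX, ⟨biprod.mapIso (Iso.refl M) e ≪≫ ⟨g, f, hgf, hfg⟩⟩⟩

end QuasiNoiseFree

end ThreadQuiver

/-! ### Tame representations are quasi noise free -/

namespace ThreadQuiver

section Splitting

variable {k : Type uk} [Field k] {V : Type u} [Quiver.{v} V] {T : ThreadQuiver.{u, v, w} V}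

open RepPwf

/-- Morphisms of representations that vanish at the vertices. -/
theorem exists_hom_of_threads {M N : RepPwf T k}
    (g : ∀ {a b : V} (α : a ⟶ b) (x : T.thread α), M.at (Obj.point α x) →ₗ[k] N.at (Obj.point α x))
    (hthr : ∀ {a b : V} {α : a ⟶ b} {x y : T.thread α} (h : x ≤ y) m,
      g α y (M.mp (Obj.thr h) m) = N.mp (Obj.thr h) (g α x m))
    (hinn : ∀ {a b : V} (α : a ⟶ b) x m, g α x (M.mp (Obj.inn α x) m) = 0)
    (hout : ∀ {a b : V} (α : a ⟶ b) x m, N.mp (Obj.out α x) (g α x m) = 0) :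
    ∃ e : M ⟶ N, (∀ {a b : V} (α : a ⟶ b) x m, app e (Obj.point α x) m = g α x m) ∧
      ∀ a m, app e (Obj.vertex a) m = 0 := by
  let G : ∀ X : Obj T, M.at X →ₗ[k] N.at X
    | .vertex _ => 0
    | .point α x => g α x
  have hl {X Y : Obj T} (p : Quiver.Path X.exit Y.entry) (m) :
      G Y (M.mp (.path p : X ⟶ Y) m) = 0 := by
    cases Y with
    | vertex a => rfl
    | @point a b α y =>
      let p' : Quiver.Path X.exit a := p
      have : (.path p : X ⟶ Obj.point α y) = (Obj.toExit X ≫ Obj.ofPath p') ≫ Obj.inn α y :=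
        (Obj.path_eq p).trans (Category.assoc _ _ _).symm
      rw [this, ← mp_mp]
      exact hinn α y _
  have hr {X Y : Obj T} (p : Quiver.Path X.exit Y.entry) (m) :
      N.mp (.path p : X ⟶ Y) (G X m) = 0 := by
    cases X with
    | vertex a => exact map_zero _
    | @point a b α x =>
      let p' : Quiver.Path b Y.entry := p
      have : (.path p : Obj.point α x ⟶ Y) = Obj.out α x ≫ Obj.ofPath p' ≫ Obj.fromEntry Y :=
        Obj.path_eq p
      rw [this, ← mp_mp]
      exact (congrArg _ (hout α x m)).trans (map_zero _)
  refine ⟨homMk G (fun {X Y} f m => ?_), fun α x m => rfl, fun a m => rfl⟩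
  change PathLike X Y at f
  cases f with
  | path p => exact (hl p m).trans (hr p m).symm
  | thread h => exact hthr h m

/-- A representation that is tame on an arrow has a finite direct sum of indecomposable
representations supported in the thread of the arrow as a direct summand, whose complement has no
noise on the arrow. -/
theorem exists_retract_of_isTameOn {M : RepPwf T k} {a b : V} {α : a ⟶ b} (hM : IsTameOn M α) :
    ∃ (U : RepPwf T k) (i : U ⟶ M) (p : M ⟶ U), i ≫ p = 𝟙 U ∧ IsFiniteSumOfIndecomposables U ∧
      U.support ⊆ Set.range (Obj.point α) ∧ ∀ x (m : M.at (Obj.point α x)),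
        app p _ m = 0 → M.mp (Obj.out α x) m = 0 → ∃ l, M.mp (Obj.inn α x) l = m := by
  obtain ⟨f, n, hf, hn, h⟩ := hM
  have hzero (M : RepPwf T k)
      (hM : ∀ x, LinearMap.ker (M.mp (Obj.out α x)) ≤ LinearMap.range (M.mp (Obj.inn α x))) :
      ∃ (U : RepPwf T k) (i : U ⟶ M) (p : M ⟶ U), i ≫ p = 𝟙 U ∧ IsFiniteSumOfIndecomposables U ∧
        U.support ⊆ Set.range (Obj.point α) ∧ ∀ x (m : M.at (Obj.point α x)),
          app p _ m = 0 → M.mp (Obj.out α x) m = 0 → ∃ l, M.mp (Obj.inn α x) l = m :=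
    let ⟨Z, hZ⟩ := HasZeroObject.zero (C := RepPwf T k)
    ⟨Z, 0, 0, hZ.eq_of_src _ _, isFiniteSum_of_isZero hZ,
      fun X hX => (notMem_support.2 (isZero_iff.1 hZ X) hX).elim, fun x m _ hm => hM x hm⟩
  by_cases hα : Nonempty (T.thread α)
  swap
  · exact hzero M fun x => (hα ⟨x⟩).elim
  obtain ⟨n, r, g, hrg, hr⟩ := exists_chain f hf n hn
  -- Induction on the total dimension at one sample point per constant piece. A split-off interval
  -- that is nonzero at `s` is nonzero at the sample point of the piece of `s`, so the complement
  -- has smaller total dimension; it is constant on the same pieces.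
  obtain ⟨d, hd⟩ : ∃ d, ∑ i, Module.finrank k (M.at (Obj.point α (g i))) = d := ⟨_, rfl⟩
  induction d using Nat.strong_induction_on generalizing M with
  | _ d ih =>
    by_cases hM : ∀ x, LinearMap.ker (M.mp (Obj.out α x)) ≤ LinearMap.range (M.mp (Obj.inn α x))
    · exact hzero M hM
    push Not at hM
    obtain ⟨s, hs⟩ := hM
    obtain ⟨J, J', ⟨e⟩, hJ, -, hJα, hJs⟩ := exists_interval_summand M α s hs
    have hJr : (biprod.inl ≫ e.inv) ≫ e.hom ≫ biprod.fst = 𝟙 J := by simp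
    have hJr' : (biprod.inr ≫ e.inv) ≫ e.hom ≫ biprod.snd = 𝟙 J' := by simp
    have hJJ' : (biprod.inr ≫ e.inv) ≫ e.hom ≫ biprod.fst = (0 : J' ⟶ J) := by simp
    have htot : (e.hom ≫ biprod.fst) ≫ (biprod.inl ≫ e.inv) +
        (e.hom ≫ biprod.snd) ≫ (biprod.inr ≫ e.inv) = 𝟙 M := by
      simp only [Category.assoc, ← Preadditive.comp_add]
      rw [← Category.assoc biprod.fst, ← Category.assoc biprod.snd, ← Preadditive.add_comp,
        biprod.total, Category.id_comp, e.hom_inv_id]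
    generalize biprod.inl ≫ e.inv = i at *
    generalize e.hom ≫ biprod.fst = p at *
    generalize biprod.inr ≫ e.inv = i' at *
    generalize e.hom ≫ biprod.snd = p' at *
    have hp (X) (j : J.at X) : app p X (app i X j) = j := congrArg (fun ψ => app ψ X j) hJr
    have hp' (X) (j : J'.at X) : app p' X (app i' X j) = j := congrArg (fun ψ => app ψ X j) hJr'
    have hi'p (X) (j : J'.at X) : app p X (app i' X j) = 0 := congrArg (fun ψ => app ψ X j) hJJ'
    have hadd (X) (m : M.at X) : app i X (app p X m) + app i' X (app p' X m) = m :=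
      congrArg (fun ψ => app ψ X m) htot
    have hle (X) : Module.finrank k (J'.at X) ≤ Module.finrank k (M.at X) :=
      LinearMap.finrank_le_finrank_of_injective (f := app i' X)
        (Function.LeftInverse.injective (hp' X))
    have hnt : Nontrivial (J.at (Obj.point α (g (r s)))) := by
      have hfs : f s = f (g (r s)) := hr _ _ (hrg _).symm
      rw [← not_subsingleton_iff_nontrivial] at hJs ⊢
      refine fun h' => hJs ?_
      rcases le_total s (g (r s)) with hsg | hsg
      · exact (bijective_mp_of_retract i p hJr (h hsg hfs)).1.subsingleton
      · exact (bijective_mp_of_retract i p hJr (h hsg hfs.symm)).2.subsingleton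
    have hlt : Module.finrank k (J'.at (Obj.point α (g (r s)))) <
        Module.finrank k (M.at (Obj.point α (g (r s)))) := by
      refine lt_of_le_of_ne (hle _) fun heq => ?_
      have hsurj := (LinearMap.injective_iff_surjective_of_finrank_eq_finrank heq).1
        (Function.LeftInverse.injective (hp' (Obj.point α (g (r s)))))
      obtain ⟨j, hj⟩ := exists_ne (0 : J.at (Obj.point α (g (r s))))
      obtain ⟨j', hj'⟩ := hsurj (app i _ j)
      exact hj (by rw [← hp _ j, ← hj', hi'p])
    obtain ⟨U, iU, pU, hU, hfin, hUα, hUM⟩ := ih _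
      (hd ▸ Finset.sum_lt_sum (fun i _ => hle _) ⟨r s, Finset.mem_univ _, hlt⟩) (M := J')
      (fun hxy hfxy => bijective_mp_of_retract i' p' hJr' (h hxy hfxy)) rfl
    have hip' : i ≫ p' = 0 := by
      have h₁ : i' ≫ p' = 𝟙 J' := hJr'
      have h₂ : i ≫ p ≫ i + i ≫ p' ≫ i' = i := by
        simpa only [Preadditive.comp_add, Category.comp_id, Category.assoc] using congrArg (i ≫ ·) htot
      rw [reassoc_of% hJr, add_eq_left] at h₂
      have := congrArg (· ≫ p') h₂
      simpa [h₁] using this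
    refine ⟨J ⊞ U, biprod.desc i (iU ≫ i'), biprod.lift p (p' ≫ pU), ?_,
      isFiniteSum_biprod hJ hfin, fun X hX => ?_, fun x m hm hm' => ?_⟩
    · refine biprod.hom_ext' _ _ (biprod.hom_ext _ _ ?_ ?_) (biprod.hom_ext _ _ ?_ ?_) <;>
        simp [hJr, reassoc_of% hJr', hU, hJJ', reassoc_of% hip']
    · by_contra hXα
      have hJX : Subsingleton (J.at X) := notMem_support.1 fun h => hXα (hJα h)
      have hUX : Subsingleton (U.at X) := notMem_support.1 fun h => hXα (hUα h)
      refine notMem_support.2 (subsingleton_of_forall_eq 0 fun m => ?_) hX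
      have : app biprod.inl X (app (biprod.fst : J ⊞ U ⟶ J) X m) +
          app biprod.inr X (app (biprod.snd : J ⊞ U ⟶ U) X m) = m :=
        congrArg (fun ψ => app ψ X m) (biprod.total (X := J) (Y := U))
      rw [← this, hJX.elim (app biprod.fst X m) 0, hUX.elim (app biprod.snd X m) 0, map_zero,
        map_zero, add_zero]
    · have h₁ : app p _ m = 0 := by
        rw [← biprod.lift_fst p (p' ≫ pU), app_comp, hm, map_zero]
      have h₂ : app pU _ (app p' _ m) = 0 := by
        rw [← app_comp, ← biprod.lift_snd p (p' ≫ pU), app_comp, hm, map_zero]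
      obtain ⟨l, hl⟩ := hUM x (app p' _ m) h₂ (by rw [← app_mp, hm', map_zero])
      refine ⟨app i' _ l, ?_⟩
      have h₃ := hadd _ m
      rw [h₁, map_zero, zero_add] at h₃
      rw [← app_mp, hl, h₃]

/-- The projectors onto the noise of the single arrows live on disjoint threads and vanish at the
vertices, so they add up, even for infinitely many arrows, to one idempotent `E`. Its image is the
noise part and its complement is noise free. -/
theorem isQuasiNoiseFree_of_isTameOn {M : RepPwf T k}
    (hM : ∀ {a b : V} (α : a ⟶ b), IsTameOn M α) : IsQuasiNoiseFree M := by
  choose U i p hip hfin hU hMU using fun (a b : V) (α : a ⟶ b) => exists_retract_of_isTameOn (hM α)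
  have hpi {a b : V} (α : a ⟶ b) (X) (m : (U a b α).at X) :
      app (p a b α) X (app (i a b α) X m) = m := congrArg (fun ψ => app ψ X m) (hip a b α)
  have hUv {a b : V} (α : a ⟶ b) (c) : Subsingleton ((U a b α).at (Obj.vertex c)) :=
    (isNoise_of_support (hU a b α)).subsingleton c
  obtain ⟨E, hE, hE0⟩ := exists_hom_of_threads (M := M) (N := M)
    (fun {a b} α x => app (p a b α ≫ i a b α) (Obj.point α x)) (fun h m => app_mp _ _ _)
    (fun {a b} α x m => by
      rw [app_mp, app_comp, (hUv α a).elim (app _ _ m) 0, map_zero, map_zero])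
    (fun {a b} α x m => by
      rw [← app_mp, app_comp, (hUv α b).elim (app (p a b α) _ _) 0, map_zero])
  have hEE : E ≫ E = E := hom_ext fun X m => by
    rw [app_comp]
    cases X with
    | vertex c => rw [hE0, hE0]
    | point α x =>
      rw [hE, hE]
      simp only [app_comp]
      rw [hpi]
  obtain ⟨N, F, j, q, j', q', hjq, hqj, hjq', hqj', ⟨e⟩⟩ := exists_biprod_of_idempotent E hEE
  have hjq (X) (n : N.at X) : app q X (app j X n) = n := congrArg (fun ψ => app ψ X n) hjq
  have hqj (X) (m : M.at X) : app j X (app q X m) = app E X m := congrArg (fun ψ => app ψ X m) hqj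
  have hjq' (X) (n : F.at X) : app q' X (app j' X n) = n := congrArg (fun ψ => app ψ X n) hjq'
  have hqj' (X) (m : M.at X) : app j' X (app q' X m) = m - app E X m :=
    congrArg (fun ψ => app ψ X m) hqj'
  have hEj (X) (n : N.at X) : app E X (app j X n) = app j X n := by rw [← hqj, hjq]
  have hNv (c : V) : Subsingleton (N.at (Obj.vertex c)) := subsingleton_of_forall_eq 0 fun n => by
    rw [← hjq _ n, ← hEj, hE0, map_zero]
  have hNoise : IsNoise N := by
    refine Set.disjoint_left.2 fun X hX => ?_
    rintro ⟨c, rfl⟩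
    exact notMem_support.2 (hNv c) hX
  have hEi {a b : V} (α : a ⟶ b) (x) (m : (U a b α).at (Obj.point α x)) :
      app E _ (app (i a b α) _ m) = app (i a b α) _ m := by
    rw [hE, app_comp, hpi]
  have hF : IsNoiseFree F := isNoiseFree_of_ker_le_range fun {a b} α x m hm => by
    -- On the complement `E`, hence also the projection to `U`, is zero, so an element killed by
    -- `out` comes from the source by the choice of `U`.
    have hEm : app E _ (app j' _ m) = 0 := by
      have := hqj' _ (app j' _ m)
      rw [hjq', eq_comm, sub_eq_self] at this
      exact this
    rw [hE, app_comp] at hEm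
    obtain ⟨l, hl⟩ := hMU a b α x (app j' _ m) (by rw [← hpi α _ (app _ _ _), hEm, map_zero])
      (by rw [← app_mp, LinearMap.mem_ker.1 hm, map_zero])
    exact ⟨app q' _ l, by rw [← app_mp, hl, hjq']⟩
  let ι (α : Σ a b : V, a ⟶ b) : U α.1 α.2.1 α.2.2 ⟶ N := i α.1 α.2.1 α.2.2 ≫ q
  -- At each point of `N` only the summand of the corresponding arrow is present, so a morphism out
  -- of `N` can be prescribed thread by thread.
  have hdesc (W : RepPwf T k) (s : ∀ α : Σ a b : V, a ⟶ b, U α.1 α.2.1 α.2.2 ⟶ W) :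
      ∃ d : N ⟶ W, ∀ {a b : V} (α : a ⟶ b) x n,
        app d (Obj.point α x) n = app (s ⟨a, b, α⟩) _ (app (p a b α) _ (app j _ n)) := by
    obtain ⟨d, hd, -⟩ := exists_hom_of_threads (M := N) (N := W)
      (fun {a b} α x => app (j ≫ p a b α ≫ s ⟨a, b, α⟩) (Obj.point α x)) (fun h m => app_mp _ _ _)
      (fun {a b} α x m => by rw [(hNv a).elim m 0, map_zero, map_zero])
      (fun {a b} α x m => by
        rw [← app_mp, app_comp, app_comp, (hUv α b).elim (app (p a b α) _ _) 0, map_zero])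
    exact ⟨d, hd⟩
  choose d hd using hdesc
  refine ⟨⟨F, N, hF, hNoise, e ≪≫ biprod.braiding _ _, fun α => U α.1 α.2.1 α.2.2,
    fun α => hU _ _ α, ι, Cofan.IsColimit.mk _ (fun s => d _ s.inj) (fun s α => ?_)
    (fun s m hm => ?_)⟩, fun α => hfin _ _ _⟩
  · obtain ⟨a, b, α⟩ := α
    refine hom_ext fun X m => ?_
    by_cases hX : X ∈ Set.range (Obj.point α)
    · obtain ⟨x, rfl⟩ := hX
      change app (d _ s.inj) _ (app q _ (app (i a b α) _ m)) = _
      rw [hd, hqj, hEi, hpi]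
    · have : Subsingleton ((U a b α).at X) := notMem_support.1 fun h => hX (hU a b α h)
      rw [this.elim m 0, map_zero, map_zero]
  · refine hom_ext fun X n => ?_
    cases X with
    | vertex c => rw [(hNv c).elim n 0, map_zero, map_zero]
    | @point a b α x =>
      rw [hd, ← hm ⟨a, b, α⟩]
      change _ = app m _ (app q _ (app (i a b α) _ (app (p a b α) _ (app j _ n))))
      rw [← app_comp (p a b α) (i a b α), ← hE, hEj, hjq]

theorem isQuasiNoiseFree_iff {M : RepPwf T k} :
    IsQuasiNoiseFree M ↔ ∀ {a b : V} (α : a ⟶ b), IsTameOn M α :=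
  ⟨fun h _ _ α => h.isTameOn α, isQuasiNoiseFree_of_isTameOn⟩

end Splitting

end ThreadQuiver

/-! ### The category of quasi noise free representations -/

namespace ThreadQuiver

section Qnf

variable {k : Type uk} [Field k] {V : Type u} [Quiver.{v} V] {T : ThreadQuiver.{u, v, w} V}

open RepPwf

theorem prop_qnf_iff {M : RepPwf T k} :
    qnf T k M ↔ ∀ {a b : V} (α : a ⟶ b), IsTameOn M α :=
  isQuasiNoiseFree_iff

instance : (qnf T k).IsClosedUnderIsomorphisms where
  of_iso e h := prop_qnf_iff.2 fun α => (prop_qnf_iff.1 h α).of_iso e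

instance : (qnf T k).ContainsZero where
  exists_zero := by
    obtain ⟨Z, hZ⟩ := HasZeroObject.zero (C := RepPwf T k)
    exact ⟨Z, hZ, prop_qnf_iff.2 fun α => .of_subsingleton fun _ => isZero_iff.1 hZ _⟩

/-- With the closure under cokernels and finite products below, this makes the full subcategory
abelian with the inherited addition of morphisms. -/
instance : (qnf T k).IsClosedUnderKernels where
  kernels_le := by
    rintro _ ⟨f, c, hc, hX, hY⟩
    exact (qnf T k).prop_of_iso ((kernelIsKernel f).conePointUniqueUpToIso hc) (prop_qnf_iff.2
      fun α => (prop_qnf_iff.1 hX α).kernel (prop_qnf_iff.1 hY α) f)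

instance : (qnf T k).IsClosedUnderCokernels where
  cokernels_le := by
    rintro _ ⟨f, c, hc, hX, hY⟩
    exact (qnf T k).prop_of_iso ((cokernelIsCokernel f).coconePointUniqueUpToIso hc)
      (prop_qnf_iff.2 fun α => (prop_qnf_iff.1 hX α).cokernel (prop_qnf_iff.1 hY α) f)

instance : (qnf T k).IsClosedUnderFiniteProducts where
  isClosedUnderLimitsOfShape J _ := ⟨by
    classical
    rintro M ⟨p⟩
    have := Fintype.ofFinite (Discrete J)
    let s (i : Discrete J) : Cone p.diag :=
      { pt := p.diag.obj i
        π := Discrete.natTrans (Pi.single (M := fun j => p.diag.obj i ⟶ p.diag.obj j) i (𝟙 _)) }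
    refine prop_qnf_iff.2 fun α => IsTameOn.sum (fun i => p.π.app i)
      (fun i => p.isLimit.lift (s i)) (p.isLimit.hom_ext fun j => ?_)
      fun i => prop_qnf_iff.1 (p.prop_diag_obj i) α
    rw [Preadditive.sum_comp, Finset.sum_eq_single j]
    · have h : (s j).π.app j = 𝟙 _ := Pi.single_eq_same _ _
      rw [Category.assoc, p.isLimit.fac, h]
      exact (Category.comp_id _).trans (Category.id_comp _).symm
    · intro i _ hij
      have h : (s i).π.app j = 0 := Pi.single_eq_of_ne hij.symm _
      rw [Category.assoc, p.isLimit.fac, h, comp_zero]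
    · simp⟩

theorem isHereditary_repQnf : IsHereditary (RepQnf T k) := by
  refine IsHereditary.of_factorization fun {E W} u => ?_
  obtain ⟨L, ι, q, hL, hιq, hι, hq, hex⟩ := exists_factorization_of_isTameOn u.hom
    (prop_qnf_iff.1 E.property) (prop_qnf_iff.1 W.property)
  let L' : RepQnf T k := ⟨L, prop_qnf_iff.2 hL⟩
  let ι' : E ⟶ L' := ObjectProperty.homMk ι
  let q' : L' ⟶ W := ObjectProperty.homMk q
  have := mono_of_injective ι hι
  have := epi_of_surjective q hq
  have hmono : Mono ι' := (qnf T k).ι.mono_of_mono_map ‹Mono ι›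
  have hepi : Epi q' := (qnf T k).ι.epi_of_epi_map ‹Epi q›
  refine ⟨L', ι', q', hmono, hepi, ObjectProperty.hom_ext _ hιq, ?_⟩
  -- The pointwise inclusion of the kernel of `q` in the image of `ι` becomes a morphism by lifting
  -- through the mono `ι`, the kernel of its cokernel.
  have h0 : (kernel.ι q').hom ≫ cokernel.π ι = 0 := hom_ext fun X x => by
    have hx : app q X (app (kernel.ι q').hom X x) = 0 :=
      congrArg (fun ψ => app ψ.hom X x) (kernel.condition q')
    obtain ⟨e, he⟩ := hex X _ hx
    rw [app_comp, ← he]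
    exact congrArg (fun ψ => app ψ X e) (cokernel.condition ι)
  exact ⟨ObjectProperty.homMk (Abelian.monoLift ι (kernel.ι q').hom h0),
    ObjectProperty.hom_ext _ (Abelian.monoLift_comp ι (kernel.ι q').hom h0)⟩

end Qnf

end ThreadQuiver

theorem mainTheorem6 (k : Type uk) [Field k] {V : Type u} [Quiver.{v} V]
    (T : ThreadQuiver.{u, v, w} V) :
    ∃ h : Abelian (T.RepQnf k),
      h.toPreadditive = Preadditive.fullSubcategory (T.qnf k) ∧
        IsHereditary (T.RepQnf k) :=
  ⟨inferInstance, rfl, ThreadQuiver.isHereditary_repQnf⟩
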